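/- Let $\Bbbk$ be an algebraically closed field and let $A=\bigoplus_{i,j\in\mathbf I}1_iA1_j$ be a locally unital $\mathbb Z$-graded associative $\Bbbk$-algebra with distinguished mutually orthogonal homogeneous idempotents $1_i$ $(i\in\mathbf I)$. Assume $A$ is locally finite-dimensional and bounded below: every $1_iA_d1_j$ is finite-dimensional, and for all $i,j$ one has $1_iA_d1_j=0$ for $d\ll0$. By a graded left $A$-module we mean one with $V=\bigoplus_{i}1_iV$; isomorphisms are degree-preserving. Assume $A$ has a graded triangular basis, that is: a subset $\mathbf S\subseteq\mathbf I$; a poset $\Lambda$ in which every set $\{\mu\le\lambda\}$ is finite; a function $\mathbf S\to\Lambda$, $s\mapsto\dot s$, with finite fibres $\mathbf S_\lambda$; and sets of homogeneous elements $\mathrm X(i,s)\subset1_iA1_s$, $\mathrm H(s,t)\subset1_sA1_t$, $\mathrm Y(t,j)\subset1_tA1_j$ $(i,j\in\mathbf I,\ s,t\in\mathbf S)$ such that, with $\mathrm X(s)=\bigcup_i\mathrm X(i,s)$ and $\mathrm Y(t)=\bigcup_j\mathrm Y(t,j)$: the products $xhy$ for $(x,h,y)\in\bigcup_{s,t}\mathrm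 X(s)\times\mathrm H(s,t)\times\mathrm Y(t)$ form a basis of $A$; $\mathrm X(s,s)=\mathrm Y(s,s)=\{1_s\}$; for $s\ne t$ in $\mathbf S$, $\mathrm X(s,t)\ne\varnothing$ implies $\dot s>\dot t$, $\mathrm H(s,t)\neq\varnothing$ implies $\dot s=\dot t$, and $\mathrm Y(s,t)\ne\varnothing$ implies $\dot s<\dot t$; and for each $i\in\mathbf I\setminus\mathbf S$ only finitely many $s\in\mathbf S$ satisfy $\mathrm X(i,s)\cup\mathrm Y(s,i)\neq\varnothing$. Put $e_\lambda=\sum_{s\in\mathbf S_\lambda}1_s$, let $A_{\ge\lambda}$ be the quotient of $A$ by the two-sided ideal generated by all $e_\mu$ with $\mu\not\ge\lambda$, let $\bar e_\lambda$ be the image of $e_\lambda$ in $A_{\geq\lambda}$, and let $A_\lambda=\bar e_\lambda A_{\ge\lambda}\bar e_\lambda$. For a graded left $A_\lambda$-module $W$ put $$j^\lambda_!W=A_{\ge\lambda}\bar e_\lambda\otimes_{A_\lambda}W,\qquad j^\lambda_*W=\bigoplus_{i\in\mathbf I}\operatorname{Hom}_{A_\lambda}(\bar e_\lambda A_{\ge\lambda}\bar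 1_i,W),$$ regarded as $A$-modules; here and below $\operatorname{Hom}$ denotes the direct sum over $d\in\mathbb Z$ of the spaces of homomorphisms that are homogeneous of degree $d$. A $\bar\Delta$-layer (resp. $\bar\nabla$-layer) of type $\lambda$ is a graded $A$-module isomorphic to $j^\lambda_!W$ (resp. $j^\lambda_*W$) for some $W$ all of whose spaces $1_sW_d$ are finite-dimensional and such that, for each $s\in\mathbf S_\lambda$, $1_sW_d=0$ for $d\ll0$ (resp. for $d\gg0$). A graded $A$-module has a $\bar\Delta$-flag (resp. $\bar\nabla$-flag) if it has a finite filtration by graded submodules, from $0$ to the whole module, whose successive quotients are $\bar\Delta$-layers (resp. $\bar\nabla$-layers) of pairwise distinct types. Let $\Gamma\subseteq\Lambda$ be a finite lower set, $e_\Gamma=\sum_{\lambda\in\Gamma}e_\lambda$, and $A_\Gamma=e_\Gamma Ae_\Gamma$. Let $j^\Gamma V=e_\Gamma V$, with left adjoint $j^\Gamma_!=Ae_\Gamma\otimes_{A_\Gamma}-$ and right adjoint $j^\Gamma_*=\bigoplus_{i}\operatorname{Hom}_{A_\Gamma}(e_\Gamma A1_i,-)$. For a graded left $A$-module $V$ put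 $V_\Gamma=Ae_\Gamma V$ and $V^\Gamma=\{v\in V: e_\Gamma Av=0\}$. Then: 1. If $V_\Gamma$ has a $\bar\Delta$-flag, then the counit $\varepsilon^\Gamma_V:j^\Gamma_!j^\Gamma V\to V$, $a\otimes v\mapsto av$, defines an isomorphism of graded modules $j^\Gamma_!j^\Gamma V\xrightarrow{\sim}V_\Gamma$. 2. If $V/V^\Gamma$ has a $\bar\nabla$-flag, then the unit $\eta^\Gamma_V:V\to j^\Gamma_*j^\Gamma V$, $v\mapsto(x\mapsto xv)$, induces an isomorphism of graded modules $V/V^\Gamma\xrightarrow{\sim}j^\Gamma_*j^\Gamma V$. -/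

import Mathlib

open scoped TensorProduct

universe uk uI uA uL uV uW

namespace GradedTriangular

/-! ### Graded vector spaces -/

section GradedSpaces

variable {k : Type uk} [Field k]

/-- `N` is a graded subspace: `N = ∑ d, N ∩ V_d`. -/
def IsHomog {V : Type*} [AddCommGroup V] [Module k V] (deg : ℤ → Submodule k V)
    (N : Submodule k V) : Prop :=
  N ≤ ⨆ d, N ⊓ deg d

theorem isInternal_of_detect {V U α : Type*} [AddCommGroup V] [Module k V] [AddCommGroup U]
    [Module k U] (deg : ℤ → Submodule k V) (htop : ∀ v, v ∈ ⨆ d, deg d)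
    (ι : α → V →ₗ[k] U) (δ : α → V →ₗ[k] ℤ →₀ U)
    (hδ : ∀ x d, ∀ v ∈ deg d, δ x v = Finsupp.single d (ι x v))
    (hι : ∀ v, (∀ x, ι x v = 0) → v = 0) : DirectSum.IsInternal deg := by
  rw [DirectSum.isInternal_submodule_iff_iSupIndep_and_iSup_eq_top]
  refine ⟨?_, (Submodule.eq_top_iff').2 htop⟩
  intro d
  rw [Submodule.disjoint_def]
  intro v hv hv'
  apply hι
  intro x
  have h : (⨆ j, ⨆ (_ : j ≠ d), deg j) ≤ LinearMap.ker (Finsupp.lapply d ∘ₗ δ x) := by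
    refine iSup_le fun j => iSup_le fun hj => ?_
    intro w hw
    simp [hδ x j w hw, hj]
  have h1 := h hv'
  simpa [hδ x d v hv] using h1

theorem exists_comp {V : Type*} [AddCommGroup V] [Module k V] {deg : ℤ → Submodule k V}
    (h : DirectSum.IsInternal deg) :
    ∃ δ : V →ₗ[k] ℤ →₀ V, ∀ d, ∀ v ∈ deg d, δ v = Finsupp.single d v := by
  let E := LinearEquiv.ofBijective (DirectSum.coeLinearMap deg) h
  refine ⟨(DirectSum.toModule k ℤ (ℤ →₀ V)
    (fun d => Finsupp.lsingle d ∘ₗ (deg d).subtype)) ∘ₗ E.symm.toLinearMap, ?_⟩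
  intro d v hv
  have : E.symm v = DirectSum.lof k ℤ (fun d => deg d) d ⟨v, hv⟩ := by
    rw [LinearEquiv.symm_apply_eq]
    exact (DirectSum.coeAddMonoidHom_of deg d ⟨v, hv⟩).symm
  simp [this]

theorem mem_iSup_deg {V : Type*} [AddCommGroup V] [Module k V] {deg : ℤ → Submodule k V}
    (h : DirectSum.IsInternal deg) (v : V) : v ∈ ⨆ d, deg d := by
  rw [h.submodule_iSup_eq_top]; trivial

/-- A property that is closed under sums and holds for homogeneous vectors holds for all. -/
theorem homog_induction {V : Type*} [AddCommGroup V] [Module k V] {deg : ℤ → Submodule k V}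
    (h : DirectSum.IsInternal deg) {P : V → Prop} (h0 : P 0)
    (hadd : ∀ v w, P v → P w → P (v + w)) (hd : ∀ d, ∀ v ∈ deg d, P v) (v : V) : P v :=
  Submodule.iSup_induction deg (motive := P) (mem_iSup_deg h v) hd h0 hadd

theorem isInternal_sub {V : Type*} [AddCommGroup V] [Module k V] {deg : ℤ → Submodule k V}
    (h : DirectSum.IsInternal deg) {N : Submodule k V} (hN : IsHomog deg N) :
    DirectSum.IsInternal fun d => (deg d).comap N.subtype := by
  obtain ⟨δ, hδ⟩ := exists_comp h
  refine isInternal_of_detect (α := Unit) _ ?_ (fun _ => N.subtype) (fun _ => δ ∘ₗ N.subtype)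
    ?_ ?_
  · rintro ⟨v, hv⟩
    have key : ∀ w ∈ ⨆ d, N ⊓ deg d, ∃ hw : w ∈ N,
        (⟨w, hw⟩ : N) ∈ ⨆ d, (deg d).comap N.subtype := by
      intro w hw
      refine Submodule.iSup_induction (fun d => N ⊓ deg d)
        (motive := fun w => ∃ hw : w ∈ N, (⟨w, hw⟩ : N) ∈ ⨆ d, (deg d).comap N.subtype)
        hw ?_ ?_ ?_
      · intro d x hx
        exact ⟨hx.1, Submodule.mem_iSup_of_mem d hx.2⟩
      · exact ⟨N.zero_mem, Submodule.zero_mem _⟩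
      · rintro x y ⟨hx, hx'⟩ ⟨hy, hy'⟩
        exact ⟨N.add_mem hx hy, Submodule.add_mem _ hx' hy'⟩
    exact (key v (hN hv)).2
  · intro _ d v hv
    exact hδ d v hv
  · intro v hv
    simpa using hv ()

theorem isInternal_quot {V : Type*} [AddCommGroup V] [Module k V] {deg : ℤ → Submodule k V}
    (h : DirectSum.IsInternal deg) {N : Submodule k V} (hN : IsHomog deg N) :
    DirectSum.IsInternal fun d => (deg d).map N.mkQ := by
  obtain ⟨δ, hδ⟩ := exists_comp h
  have hk : N ≤ LinearMap.ker (Finsupp.mapRange.linearMap (α := ℤ) N.mkQ ∘ₗ δ) := by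
    refine hN.trans (iSup_le fun d => ?_)
    rintro v ⟨hv, hv'⟩
    simp only [LinearMap.mem_ker, LinearMap.comp_apply, hδ d v hv']
    have : N.mkQ v = 0 := by simpa using hv
    simp only [Finsupp.mapRange.linearMap_apply, Finsupp.mapRange_single, this,
      Finsupp.single_zero]
  refine isInternal_of_detect (α := Unit) _ ?_ (fun _ => LinearMap.id)
    (fun _ => N.liftQ _ hk) ?_ ?_
  · intro v
    obtain ⟨v, rfl⟩ := N.mkQ_surjective v
    rw [← Submodule.map_iSup]
    exact Submodule.mem_map_of_mem (mem_iSup_deg h v)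
  · rintro _ d _ ⟨v, hv, rfl⟩
    simp [hδ d v hv]
  · intro v hv
    exact hv ()

theorem isHomog_of_proj {V : Type*} [AddCommGroup V] [Module k V] {deg : ℤ → Submodule k V}
    (h : DirectSum.IsInternal deg) {N : Submodule k V} (p : V →ₗ[k] V) (hp : ∀ v, p v ∈ N)
    (hp' : ∀ v ∈ N, p v = v) (hd : ∀ d, ∀ v ∈ deg d, p v ∈ deg d) : IsHomog deg N := by
  intro v hv
  rw [← hp' v hv]
  refine homog_induction h (P := fun v => p v ∈ ⨆ d, N ⊓ deg d) (by simp) ?_ ?_ v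
  · intro v w hv hw
    rw [map_add]
    exact Submodule.add_mem _ hv hw
  · intro d v hv
    exact Submodule.mem_iSup_of_mem d ⟨hp v, hd d v hv⟩

theorem isHomog_of_span {V : Type*} [AddCommGroup V] [Module k V] {deg : ℤ → Submodule k V}
    {s : Set V} (hs : ∀ v ∈ s, v ∈ ⨆ d, Submodule.span k s ⊓ deg d) :
    IsHomog deg (Submodule.span k s) :=
  Submodule.span_le.2 hs

/-- If a linear map is homogeneous of degree `m`, its kernel is a graded subspace, and so is
any intersection of such kernels. -/
theorem isHomog_of_ker {V : Type*} [AddCommGroup V] [Module k V] {deg : ℤ → Submodule k V}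
    (h : DirectSum.IsInternal deg) {N : Submodule k V} {α : Type*} (f : α → V →ₗ[k] V)
    (m : α → ℤ) (hf : ∀ a d, ∀ v ∈ deg d, f a v ∈ deg (m a + d))
    (hN : ∀ v, v ∈ N ↔ ∀ a, f a v = 0) : IsHomog deg N := by
  obtain ⟨δ, hδ⟩ := exists_comp h
  intro v hv
  have h1 : ∀ a v, δ (f a v) =
      Finsupp.mapDomain (fun d => m a + d) (Finsupp.mapRange.linearMap (f a) (δ v)) := by
    intro a v
    refine homog_induction h (P := fun v => δ (f a v) =
      Finsupp.mapDomain (fun d => m a + d) (Finsupp.mapRange.linearMap (f a) (δ v))) ?_ ?_ ?_ v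
    · simp
    · intro v w hv hw
      simp only [map_add, hv, hw, Finsupp.mapDomain_add]
    · intro d v hv
      rw [hδ d v hv, hδ _ _ (hf a d v hv)]
      simp [Finsupp.mapDomain_single]
  have h2 : ∀ v d, δ v d ∈ deg d := by
    intro v d
    refine homog_induction h (P := fun v => δ v d ∈ deg d) (by simp) ?_ ?_ v
    · intro v w hv hw
      simpa using Submodule.add_mem _ hv hw
    · intro e v hv
      rw [hδ e v hv, Finsupp.single_apply]
      split_ifs with he
      · exact he ▸ hv
      · exact Submodule.zero_mem _
  have h3 : ∀ v, (δ v).sum (fun _ w => w) = v := by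
    intro v
    refine homog_induction h (P := fun v => (δ v).sum (fun _ w => w) = v) (by simp) ?_ ?_ v
    · intro v w hv hw
      rw [map_add, Finsupp.sum_add_index' (by simp) (by simp), hv, hw]
    · intro e v hv
      rw [hδ e v hv]
      simp
  have h4 : ∀ d, δ v d ∈ N := by
    intro d
    rw [hN]
    intro a
    have h5 := h1 a v
    rw [(hN v).1 hv a, map_zero] at h5
    have h6 := Finsupp.mapDomain_injective (add_right_injective (m a))
      (h5.symm.trans Finsupp.mapDomain_zero.symm)
    have h7 := DFunLike.congr_fun h6 d
    simpa using h7
  rw [← h3 v]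
  exact Submodule.sum_mem _ fun d _ => Submodule.mem_iSup_of_mem d ⟨h4 d, h2 v d⟩

/-- The grading of a tensor product over the ground field. -/
def tensorDeg {V W : Type*} [AddCommGroup V] [Module k V] [AddCommGroup W] [Module k W]
    (dV : ℤ → Submodule k V) (dW : ℤ → Submodule k W) (n : ℤ) : Submodule k (V ⊗[k] W) :=
  Submodule.span k {z | ∃ c d v w, c + d = n ∧ v ∈ dV c ∧ w ∈ dW d ∧ z = v ⊗ₜ[k] w}

theorem isInternal_tensor {V W : Type*} [AddCommGroup V] [Module k V] [AddCommGroup W]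
    [Module k W] {dV : ℤ → Submodule k V} {dW : ℤ → Submodule k W}
    (hV : DirectSum.IsInternal dV) (hW : DirectSum.IsInternal dW) :
    DirectSum.IsInternal (tensorDeg dV dW) := by
  obtain ⟨δ, hδ⟩ := exists_comp hV
  obtain ⟨ε, hε⟩ := exists_comp hW
  let δ' : V ⊗[k] W →ₗ[k] ℤ →₀ (V ⊗[k] W) :=
    Finsupp.lmapDomain _ k (fun p : ℤ × ℤ => p.1 + p.2) ∘ₗ
      (finsuppTensorFinsupp k k V W ℤ ℤ).toLinearMap ∘ₗ TensorProduct.map δ ε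
  refine isInternal_of_detect (α := Unit) _ ?_ (fun _ => LinearMap.id) (fun _ => δ') ?_ ?_
  · intro z
    induction z using TensorProduct.induction_on with
    | zero => exact Submodule.zero_mem _
    | add x y hx hy => exact Submodule.add_mem _ hx hy
    | tmul v w =>
      refine homog_induction hV
        (P := fun v => v ⊗ₜ[k] w ∈ ⨆ d, tensorDeg dV dW d) (by simp) ?_ ?_ v
      · intro x y hx hy
        rw [TensorProduct.add_tmul]
        exact Submodule.add_mem _ hx hy
      · intro c x hx
        refine homog_induction hW
          (P := fun w => x ⊗ₜ[k] w ∈ ⨆ d, tensorDeg dV dW d) (by simp) ?_ ?_ w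
        · intro y z hy hz
          rw [TensorProduct.tmul_add]
          exact Submodule.add_mem _ hy hz
        · intro d y hy
          exact Submodule.mem_iSup_of_mem (c + d)
            (Submodule.subset_span ⟨c, d, x, y, rfl, hx, hy, rfl⟩)
  · intro _ n z hz
    refine Submodule.span_induction
      (p := fun z _ => δ' z = Finsupp.single n (LinearMap.id (R := k) z)) ?_ ?_ ?_ ?_ hz
    · rintro _ ⟨c, d, v, w, rfl, hv, hw, rfl⟩
      simp [δ', hδ c v hv, hε d w hw, Finsupp.mapDomain_single]
    · simp
    · intro x y _ _ hx hy
      rw [map_add, hx, hy]; simp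
    · intro c x _ hx
      rw [map_smul, hx]; simp
  · intro v hv
    exact hv ()

end GradedSpaces

/-! ### Locally unital graded algebras -/

/-- A locally unital graded algebra: a (not necessarily unital) associative `k`-algebra
`A = ⨁ A_d` with mutually orthogonal homogeneous idempotents `1_i` such that
`A = ⨁ 1_i A 1_j`.  A homogeneous idempotent automatically has degree `0`, and the sum of the
spaces `1_i A 1_j` is automatically direct, by orthogonality. -/
structure GAlg (k : Type uk) [Field k] (I : Type uI) where
  carrier : Type uA
  [ring : NonUnitalRing carrier]
  [module : Module k carrier]
  [isScalarTower : IsScalarTower k carrier carrier]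
  [smulCommClass : SMulCommClass k carrier carrier]
  deg : ℤ → Submodule k carrier
  isInternal_deg : DirectSum.IsInternal deg
  mul_mem_deg : ∀ {m n : ℤ} {a b : carrier}, a ∈ deg m → b ∈ deg n → a * b ∈ deg (m + n)
  one : I → carrier
  one_mem_deg : ∀ i, one i ∈ deg 0
  one_mul_one : ∀ i, one i * one i = one i
  one_mul_one_of_ne : ∀ i j, i ≠ j → one i * one j = 0
  span_peirce : Submodule.span k {a | ∃ i j b, a = one i * b * one j} = ⊤

instance {k : Type uk} [Field k] {I : Type uI} : CoeSort (GAlg.{uk, uI, uA} k I) (Type uA) :=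
  ⟨GAlg.carrier⟩

attribute [instance] GAlg.ring GAlg.module GAlg.isScalarTower GAlg.smulCommClass

namespace GAlg

variable {k : Type uk} [Field k] {I : Type uI} (A : GAlg.{uk, uI, uA} k I)

/-- The space `1_i A_d 1_j`. -/
def piece (i j : I) (d : ℤ) : Submodule k A where
  carrier := {a | a ∈ A.deg d ∧ A.one i * a = a ∧ a * A.one j = a}
  zero_mem' := ⟨Submodule.zero_mem _, by simp, by simp⟩
  add_mem' := fun ⟨h1, h2, h3⟩ ⟨h4, h5, h6⟩ =>
    ⟨Submodule.add_mem _ h1 h4, by rw [mul_add, h2, h5], by rw [add_mul, h3, h6]⟩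
  smul_mem' := fun c _ ⟨h1, h2, h3⟩ =>
    ⟨Submodule.smul_mem _ c h1, by rw [mul_smul_comm, h2], by rw [smul_mul_assoc, h3]⟩

/-- `A` is locally finite-dimensional and bounded below. -/
def LocFinDimBddBelow : Prop :=
  (∀ i j d, FiniteDimensional k (A.piece i j d)) ∧
    ∀ i j, ∃ N : ℤ, ∀ d < N, A.piece i j d = ⊥

/-- The idempotent `∑_{i ∈ T} 1_i`. -/
def idem (T : Finset I) : A := ∑ i ∈ T, A.one i

theorem idem_mem_deg (T : Finset I) : A.idem T ∈ A.deg 0 :=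
  Submodule.sum_mem _ fun i _ => A.one_mem_deg i

theorem one_mul_idem {T : Finset I} {i : I} (h : i ∈ T) : A.one i * A.idem T = A.one i := by
  unfold idem
  rw [Finset.mul_sum, Finset.sum_eq_single_of_mem i h, A.one_mul_one]
  intro j _ hj
  exact A.one_mul_one_of_ne i j hj.symm

theorem idem_mul_one {T : Finset I} {i : I} (h : i ∈ T) : A.idem T * A.one i = A.one i := by
  unfold idem
  rw [Finset.sum_mul, Finset.sum_eq_single_of_mem i h, A.one_mul_one]
  intro j _ hj
  exact A.one_mul_one_of_ne j i hj

theorem idem_mul_idem_of_subset {T U : Finset I} (h : T ⊆ U) :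
    A.idem U * A.idem T = A.idem T := by
  conv_lhs => rw [show A.idem T = ∑ i ∈ T, A.one i from rfl]
  rw [Finset.mul_sum]
  exact Finset.sum_congr rfl fun i hi => A.idem_mul_one (h hi)

theorem idem_mul_idem (T : Finset I) : A.idem T * A.idem T = A.idem T :=
  A.idem_mul_idem_of_subset (Finset.Subset.refl T)

/-- An additive property that holds for all `1_i b 1_j` with `b` homogeneous holds
everywhere. -/
theorem peirce_induction {P : A → Prop} (h0 : P 0) (hadd : ∀ a b, P a → P b → P (a + b))
    (h : ∀ i j d, ∀ b ∈ A.deg d, P (A.one i * b * A.one j)) (a : A) : P a := by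
  have hs : ∀ i j b, P (A.one i * b * A.one j) := by
    intro i j b
    refine homog_induction A.isInternal_deg (P := fun b => P (A.one i * b * A.one j))
      (by simpa using h0) ?_ (h i j) b
    intro v w hv hw
    rw [mul_add, add_mul]
    exact hadd _ _ hv hw
  have ha : a ∈ Submodule.span k {a | ∃ i j b, a = A.one i * b * A.one j} := by
    rw [A.span_peirce]; trivial
  have key : P a ∧ ∀ c : k, P (c • a) := by
    refine Submodule.span_induction (p := fun a _ => P a ∧ ∀ c : k, P (c • a))
      ?_ ?_ ?_ ?_ ha
    · rintro _ ⟨i, j, b, rfl⟩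
      refine ⟨hs i j b, fun c => ?_⟩
      rw [← smul_mul_assoc, ← mul_smul_comm]
      exact hs i j _
    · exact ⟨h0, fun c => by simpa using h0⟩
    · rintro x y _ _ ⟨hx, hx'⟩ ⟨hy, hy'⟩
      refine ⟨hadd _ _ hx hy, fun c => ?_⟩
      rw [smul_add]
      exact hadd _ _ (hx' c) (hy' c)
    · rintro c x _ ⟨_, hx⟩
      refine ⟨hx c, fun c' => ?_⟩
      rw [smul_smul]
      exact hx _
  exact key.1

/-- A graded two-sided ideal. -/
structure GIdeal where
  toSubmodule : Submodule k A
  mul_mem_left : ∀ (a : A) {x : A}, x ∈ toSubmodule → a * x ∈ toSubmodule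
  mul_mem_right : ∀ (a : A) {x : A}, x ∈ toSubmodule → x * a ∈ toSubmodule
  homog : IsHomog A.deg toSubmodule

/-- The two-sided ideal generated by a set of homogeneous elements of degree `0`; as `A` is
locally unital, this is the span of all products `a x b` with `x` in the set. -/
def idealSpan (E : Set A) (hE : E ⊆ A.deg 0) : A.GIdeal where
  toSubmodule := Submodule.span k {z | ∃ a, ∃ x ∈ E, ∃ b, z = a * x * b}
  mul_mem_left := by
    intro c x hx
    refine Submodule.span_induction (p := fun x _ => c * x ∈ _) ?_ ?_ ?_ ?_ hx
    · rintro _ ⟨a, x, hx, b, rfl⟩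
      exact Submodule.subset_span ⟨c * a, x, hx, b, by simp only [mul_assoc]⟩
    · simp
    · intro x y _ _ hx hy
      rw [mul_add]; exact Submodule.add_mem _ hx hy
    · intro r x _ hx
      rw [mul_smul_comm]; exact Submodule.smul_mem _ r hx
  mul_mem_right := by
    intro c x hx
    refine Submodule.span_induction (p := fun x _ => x * c ∈ _) ?_ ?_ ?_ ?_ hx
    · rintro _ ⟨a, x, hx, b, rfl⟩
      exact Submodule.subset_span ⟨a, x, hx, b * c, by simp only [mul_assoc]⟩
    · simp
    · intro x y _ _ hx hy
      rw [add_mul]; exact Submodule.add_mem _ hx hy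
    · intro r x _ hx
      rw [smul_mul_assoc]; exact Submodule.smul_mem _ r hx
  homog := by
    apply isHomog_of_span
    rintro _ ⟨a, x, hx, b, rfl⟩
    refine homog_induction A.isInternal_deg (P := fun a => a * x * b ∈ _) (by simp) ?_ ?_ a
    · intro v w hv hw
      rw [add_mul, add_mul]; exact Submodule.add_mem _ hv hw
    intro m a ha
    refine homog_induction A.isInternal_deg (P := fun b => a * x * b ∈ _) (by simp) ?_ ?_ b
    · intro v w hv hw
      rw [mul_add]; exact Submodule.add_mem _ hv hw
    intro n b hb
    exact Submodule.mem_iSup_of_mem (m + 0 + n)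
      ⟨Submodule.subset_span ⟨a, x, hx, b, rfl⟩, A.mul_mem_deg (A.mul_mem_deg ha (hE hx)) hb⟩

variable {A} in
/-- The multiplication of the quotient algebra `A / J`. -/
def quotMul (J : A.GIdeal) :
    (A ⧸ J.toSubmodule) →ₗ[k] (A ⧸ J.toSubmodule) →ₗ[k] (A ⧸ J.toSubmodule) :=
  J.toSubmodule.liftQ
    { toFun := fun a => J.toSubmodule.mapQ J.toSubmodule (LinearMap.mulLeft k a)
        fun _ hx => J.mul_mem_left a hx
      map_add' := by
        intro a b
        refine Submodule.linearMap_qext _ (LinearMap.ext fun x => ?_)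
        exact congrArg J.toSubmodule.mkQ (add_mul a b x)
      map_smul' := by
        intro c a
        refine Submodule.linearMap_qext _ (LinearMap.ext fun x => ?_)
        exact congrArg J.toSubmodule.mkQ (smul_mul_assoc c a x) }
    (by
      intro a ha
      rw [LinearMap.mem_ker]
      refine Submodule.linearMap_qext _ (LinearMap.ext fun x => ?_)
      exact (Submodule.Quotient.mk_eq_zero _).2 (J.mul_mem_right x ha))

/-- The quotient algebra `A / J`, with idempotents and grading induced from `A`. -/
def quot (J : A.GIdeal) : GAlg.{uk, uI, uA} k I :=
  letI : NonUnitalRing (A ⧸ J.toSubmodule) :=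
    { (inferInstance : AddCommGroup (A ⧸ J.toSubmodule)) with
      mul := fun a b => quotMul J a b
      left_distrib := fun a b c => (quotMul J a).map_add b c
      right_distrib := fun a b c => by
        change quotMul J (a + b) c = quotMul J a c + quotMul J b c
        simp
      zero_mul := fun a => by
        change quotMul J 0 a = 0
        simp
      mul_zero := fun a => (quotMul J a).map_zero
      mul_assoc := fun a b c => by
        obtain ⟨a, rfl⟩ := J.toSubmodule.mkQ_surjective a
        obtain ⟨b, rfl⟩ := J.toSubmodule.mkQ_surjective b
        obtain ⟨c, rfl⟩ := J.toSubmodule.mkQ_surjective c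
        exact congrArg J.toSubmodule.mkQ (mul_assoc a b c) }
  { carrier := A ⧸ J.toSubmodule
    isScalarTower := ⟨fun c a b => by
      change quotMul J (c • a) b = c • quotMul J a b
      simp⟩
    smulCommClass := ⟨fun c a b => ((quotMul J a).map_smul c b).symm⟩
    deg := fun d => (A.deg d).map J.toSubmodule.mkQ
    isInternal_deg := isInternal_quot A.isInternal_deg J.homog
    mul_mem_deg := by
      rintro m n _ _ ⟨a, ha, rfl⟩ ⟨b, hb, rfl⟩
      exact ⟨a * b, A.mul_mem_deg ha hb, rfl⟩
    one := fun i => J.toSubmodule.mkQ (A.one i)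
    one_mem_deg := fun i => ⟨_, A.one_mem_deg i, rfl⟩
    one_mul_one := fun i => congrArg J.toSubmodule.mkQ (A.one_mul_one i)
    one_mul_one_of_ne := fun i j h => by
      have h1 := congrArg J.toSubmodule.mkQ (A.one_mul_one_of_ne i j h)
      rw [map_zero] at h1
      exact h1
    span_peirce := by
      rw [Submodule.eq_top_iff']
      intro a
      obtain ⟨a, rfl⟩ := J.toSubmodule.mkQ_surjective a
      refine A.peirce_induction (P := fun a => J.toSubmodule.mkQ a ∈ _) ?_ ?_ ?_ a
      · rw [map_zero]; exact Submodule.zero_mem _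
      · intro a b ha hb
        rw [map_add]; exact Submodule.add_mem _ ha hb
      · intro i j d b _
        exact Submodule.subset_span ⟨i, j, J.toSubmodule.mkQ b, rfl⟩ }

/-- The quotient map `A → A / J`. -/
def quotMap (J : A.GIdeal) : A →ₗ[k] A.quot J := J.toSubmodule.mkQ

theorem quotMap_mul (J : A.GIdeal) (a b : A) :
    A.quotMap J (a * b) = A.quotMap J a * A.quotMap J b := rfl

/-- The subalgebra `e A e`, where `e = ∑_{i ∈ T} 1_i`. -/
def cornerSub (T : Finset I) : NonUnitalSubalgebra k A where
  carrier := {a | A.idem T * a = a ∧ a * A.idem T = a}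
  zero_mem' := ⟨by simp, by simp⟩
  add_mem' := fun ⟨h2, h3⟩ ⟨h5, h6⟩ => ⟨by rw [mul_add, h2, h5], by rw [add_mul, h3, h6]⟩
  smul_mem' := fun c _ ⟨h2, h3⟩ => ⟨by rw [mul_smul_comm, h2], by rw [smul_mul_assoc, h3]⟩
  mul_mem' := fun ⟨h2, _⟩ ⟨_, h6⟩ => ⟨by rw [← mul_assoc, h2], by rw [mul_assoc, h6]⟩

/-- The idempotent truncation `e A e`, `e = ∑_{i ∈ T} 1_i`, as a locally unital graded algebra
with distinguished idempotents `1_i` (`i ∈ T`).  It is unital with identity element `e`. -/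
def corner (T : Finset I) : GAlg.{uk, uI, uA} k T where
  carrier := A.cornerSub T
  deg := fun d => (A.deg d).comap (A.cornerSub T).toSubmodule.subtype
  isInternal_deg := by
    refine isInternal_sub (N := (A.cornerSub T).toSubmodule) A.isInternal_deg
      (isHomog_of_proj A.isInternal_deg
        (LinearMap.mulLeft k (A.idem T) ∘ₗ LinearMap.mulRight k (A.idem T)) ?_ ?_ ?_)
    · intro a
      refine ⟨?_, ?_⟩
      · simp only [LinearMap.comp_apply, LinearMap.mulLeft_apply, LinearMap.mulRight_apply]
        rw [← mul_assoc, idem_mul_idem]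
      · simp only [LinearMap.comp_apply, LinearMap.mulLeft_apply, LinearMap.mulRight_apply]
        rw [mul_assoc, mul_assoc, idem_mul_idem]
    · rintro a ⟨h1, h2⟩
      simp only [LinearMap.comp_apply, LinearMap.mulLeft_apply, LinearMap.mulRight_apply, h2, h1]
    · intro d a ha
      have := A.mul_mem_deg (A.idem_mem_deg T) (A.mul_mem_deg ha (A.idem_mem_deg T))
      simpa using this
  mul_mem_deg := fun ha hb => A.mul_mem_deg ha hb
  one := fun i => ⟨A.one i, A.idem_mul_one i.2, A.one_mul_idem i.2⟩
  one_mem_deg := fun i => A.one_mem_deg i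
  one_mul_one := fun i => Subtype.ext (A.one_mul_one i)
  one_mul_one_of_ne := fun i j h =>
    Subtype.ext (A.one_mul_one_of_ne i j fun h' => h (Subtype.ext h'))
  span_peirce := by
    rw [Submodule.eq_top_iff']
    rintro ⟨a, ha⟩
    have key : (⟨a, ha⟩ : A.cornerSub T) = ∑ i : T, ∑ j : T,
        (⟨A.one i, A.idem_mul_one i.2, A.one_mul_idem i.2⟩ : A.cornerSub T) * ⟨a, ha⟩ *
        (⟨A.one j, A.idem_mul_one j.2, A.one_mul_idem j.2⟩ : A.cornerSub T) := by
      apply Subtype.ext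
      have h1 : A.idem T = ∑ i : T, A.one i := (Finset.sum_coe_sort T A.one).symm
      have h2 : a = A.idem T * a * A.idem T := by rw [ha.1, ha.2]
      push_cast
      conv_lhs => rw [h2, h1]
      simp only [Finset.sum_mul, Finset.mul_sum]
      exact Finset.sum_comm
    rw [key]
    exact Submodule.sum_mem _ fun i _ => Submodule.sum_mem _ fun j _ =>
      Submodule.subset_span ⟨i, j, _, rfl⟩

/-- The inclusion `e A e → A`. -/
def cornerIncl (T : Finset I) : A.corner T →ₗ[k] A := (A.cornerSub T).toSubmodule.subtype

variable {A} in
theorem cornerIncl_mul {T : Finset I} (a b : A.corner T) :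
    A.cornerIncl T (a * b) = A.cornerIncl T a * A.cornerIncl T b := rfl

variable {A} in
theorem cornerIncl_prop {T : Finset I} (a : A.corner T) :
    A.idem T * A.cornerIncl T a = A.cornerIncl T a ∧
      A.cornerIncl T a * A.idem T = A.cornerIncl T a := a.2

/-- The subspace `A e`. -/
def leftIdeal (T : Finset I) : Submodule k A where
  carrier := {a | a * A.idem T = a}
  zero_mem' := by simp
  add_mem' := fun {a b} (h : a * _ = a) (h' : b * _ = b) => by
    change (a + b) * _ = _
    rw [add_mul, h, h']
  smul_mem' := fun c a (h : a * _ = a) => by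
    change (c • a) * _ = _
    rw [smul_mul_assoc, h]

/-- The subspace `e A`. -/
def rightIdeal (T : Finset I) : Submodule k A where
  carrier := {a | A.idem T * a = a}
  zero_mem' := by simp
  add_mem' := fun {a b} (h : _ * a = a) (h' : _ * b = b) => by
    change _ * (a + b) = _
    rw [mul_add, h, h']
  smul_mem' := fun c a (h : _ * a = a) => by
    change _ * (c • a) = _
    rw [mul_smul_comm, h]

theorem isInternal_leftIdeal (T : Finset I) :
    DirectSum.IsInternal fun d => (A.deg d).comap (A.leftIdeal T).subtype := by
  refine isInternal_sub A.isInternal_deg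
    (isHomog_of_proj A.isInternal_deg (LinearMap.mulRight k (A.idem T)) ?_ ?_ ?_)
  · intro a
    change a * A.idem T * A.idem T = a * A.idem T
    rw [mul_assoc, idem_mul_idem]
  · exact fun a ha => ha
  · intro d a ha
    simpa using A.mul_mem_deg ha (A.idem_mem_deg T)

/-- The left action of `A` on `A e`. -/
def leftIdealMul (T : Finset I) : A →ₗ[k] A.leftIdeal T →ₗ[k] A.leftIdeal T :=
  LinearMap.mk₂ k
    (fun a x => ⟨a * (x : A), by
      change a * (x : A) * A.idem T = a * (x : A)
      rw [mul_assoc, show (x : A) * A.idem T = x from x.2]⟩)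
    (fun a b x => Subtype.ext (add_mul a b (x : A)))
    (fun c a x => Subtype.ext (smul_mul_assoc c a (x : A)))
    (fun a x y => Subtype.ext (mul_add a (x : A) (y : A)))
    (fun c a x => Subtype.ext (mul_smul_comm c a (x : A)))

/-- The right action of `e A e` on `A e`. -/
def leftIdealMulCorner (T : Finset I) (b : A.corner T) (x : A.leftIdeal T) : A.leftIdeal T :=
  ⟨(x : A) * A.cornerIncl T b, by
    change (x : A) * A.cornerIncl T b * A.idem T = (x : A) * A.cornerIncl T b
    rw [mul_assoc, (cornerIncl_prop b).2]⟩

/-- The left action of `e A e` on `e A`. -/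
def rightIdealCornerMul (T : Finset I) (b : A.corner T) (x : A.rightIdeal T) :
    A.rightIdeal T :=
  ⟨A.cornerIncl T b * (x : A), by
    change A.idem T * (A.cornerIncl T b * (x : A)) = A.cornerIncl T b * (x : A)
    rw [← mul_assoc, (cornerIncl_prop b).1]⟩

/-- The right action of `A` on `e A`; the algebra element is the first argument. -/
def rightIdealMul (T : Finset I) : A →ₗ[k] A.rightIdeal T →ₗ[k] A.rightIdeal T :=
  LinearMap.mk₂ k
    (fun a x => ⟨(x : A) * a, by
      change A.idem T * ((x : A) * a) = (x : A) * a
      rw [← mul_assoc, show A.idem T * (x : A) = x from x.2]⟩)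
    (fun a b x => Subtype.ext (mul_add (x : A) a b))
    (fun c a x => Subtype.ext (mul_smul_comm c (x : A) a))
    (fun a x y => Subtype.ext (add_mul (x : A) (y : A) a))
    (fun c a x => Subtype.ext (smul_mul_assoc c (x : A) a))

end GAlg

/-! ### Graded modules -/

/-- A (locally unital) graded left `A`-module: `V = ⨁ V_d`, `A_m V_n ⊆ V_{m+n}` and
`V = ⨁ 1_i V` (the sum being automatically direct). -/
structure GMod {k : Type uk} [Field k] {I : Type uI} (A : GAlg.{uk, uI, uA} k I) where
  carrier : Type uV
  [addCommGroup : AddCommGroup carrier]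
  [module : Module k carrier]
  act : A →ₗ[k] carrier →ₗ[k] carrier
  act_mul : ∀ (a b : A) (v : carrier), act (a * b) v = act a (act b v)
  deg : ℤ → Submodule k carrier
  isInternal_deg : DirectSum.IsInternal deg
  act_mem_deg : ∀ {m n : ℤ} {a : A} {v : carrier},
    a ∈ A.deg m → v ∈ deg n → act a v ∈ deg (m + n)
  span_weight : Submodule.span k {v | ∃ i w, v = act (A.one i) w} = ⊤

instance {k : Type uk} [Field k] {I : Type uI} {A : GAlg.{uk, uI, uA} k I} :
    CoeSort (GMod.{uk, uI, uA, uV} A) (Type uV) :=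
  ⟨GMod.carrier⟩

attribute [instance] GMod.addCommGroup GMod.module

namespace GMod

variable {k : Type uk} [Field k] {I : Type uI} {A : GAlg.{uk, uI, uA} k I}

/-- Degree-preserving homomorphisms of graded modules. -/
structure Hom (V : GMod.{uk, uI, uA, uV} A) (W : GMod.{uk, uI, uA, uW} A) where
  toLin : V →ₗ[k] W
  map_act : ∀ (a : A) (v : V), toLin (V.act a v) = W.act a (toLin v)
  map_deg : ∀ (d : ℤ), ∀ v ∈ V.deg d, toLin v ∈ W.deg d

/-- Degree-preserving isomorphisms of graded modules. -/
structure Iso (V : GMod.{uk, uI, uA, uV} A) (W : GMod.{uk, uI, uA, uW} A) where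
  toEquiv : V ≃ₗ[k] W
  map_act : ∀ (a : A) (v : V), toEquiv (V.act a v) = W.act a (toEquiv v)
  map_deg : ∀ (d : ℤ) (v : V), toEquiv v ∈ W.deg d ↔ v ∈ V.deg d

/-- The space `1_i V_d`. -/
def piece (V : GMod.{uk, uI, uA, uV} A) (i : I) (d : ℤ) : Submodule k V where
  carrier := {v | v ∈ V.deg d ∧ V.act (A.one i) v = v}
  zero_mem' := ⟨Submodule.zero_mem _, by simp⟩
  add_mem' := fun ⟨h1, h2⟩ ⟨h3, h4⟩ => ⟨Submodule.add_mem _ h1 h3, by rw [map_add, h2, h4]⟩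
  smul_mem' := fun c _ ⟨h1, h2⟩ => ⟨Submodule.smul_mem _ c h1, by rw [map_smul, h2]⟩

def LocFinDim (V : GMod.{uk, uI, uA, uV} A) : Prop :=
  ∀ i d, FiniteDimensional k (V.piece i d)

def BddBelow (V : GMod.{uk, uI, uA, uV} A) : Prop :=
  ∀ i, ∃ N : ℤ, ∀ d < N, V.piece i d = ⊥

def BddAbove (V : GMod.{uk, uI, uA, uV} A) : Prop :=
  ∀ i, ∃ N : ℤ, ∀ d > N, V.piece i d = ⊥

theorem exists_idem (V : GMod.{uk, uI, uA, uV} A) (v : V) :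
    ∃ F : Finset I, V.act (A.idem F) v = v := by
  classical
  have hv : v ∈ Submodule.span k {v | ∃ i w, v = V.act (A.one i) w} := by
    rw [V.span_weight]; trivial
  refine Submodule.span_induction (p := fun v _ => ∃ F : Finset I, V.act (A.idem F) v = v)
    ?_ ?_ ?_ ?_ hv
  · rintro _ ⟨i, w, rfl⟩
    exact ⟨{i}, by rw [← V.act_mul, A.idem_mul_one (Finset.mem_singleton_self i)]⟩
  · exact ⟨∅, by simp⟩
  · rintro x y _ _ ⟨F, hF⟩ ⟨G, hG⟩
    refine ⟨F ∪ G, ?_⟩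
    have h1 : V.act (A.idem (F ∪ G)) x = x := by
      rw [← hF, ← V.act_mul, A.idem_mul_idem_of_subset Finset.subset_union_left]
    have h2 : V.act (A.idem (F ∪ G)) y = y := by
      rw [← hG, ← V.act_mul, A.idem_mul_idem_of_subset Finset.subset_union_right]
    rw [map_add, h1, h2]
  · rintro c x _ ⟨F, hF⟩
    exact ⟨F, by rw [map_smul, hF]⟩

theorem act_idem {M : Type*} [AddCommGroup M] [Module k M] (f : A →ₗ[k] M →ₗ[k] M)
    (F : Finset I) (v : M) : f (A.idem F) v = ∑ i ∈ F, f (A.one i) v := by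
  simp [GAlg.idem]

theorem span_weight_of {M : Type*} [AddCommGroup M] [Module k M] (f : A →ₗ[k] M →ₗ[k] M)
    (h : ∀ v, ∃ F : Finset I, f (A.idem F) v = v) :
    Submodule.span k {v | ∃ i w, v = f (A.one i) w} = ⊤ := by
  rw [Submodule.eq_top_iff']
  intro v
  obtain ⟨F, hF⟩ := h v
  rw [← hF, act_idem]
  exact Submodule.sum_mem _ fun i _ => Submodule.subset_span ⟨i, v, rfl⟩

end GMod

theorem GAlg.exists_idem_mul {k : Type uk} [Field k] {I : Type uI} (A : GAlg.{uk, uI, uA} k I)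
    (a : A) : ∃ F : Finset I, A.idem F * a = a := by
  classical
  refine A.peirce_induction (P := fun a => ∃ F : Finset I, A.idem F * a = a) ⟨∅, by simp⟩
    ?_ ?_ a
  · rintro x y ⟨F, hF⟩ ⟨G, hG⟩
    refine ⟨F ∪ G, ?_⟩
    have h1 : A.idem (F ∪ G) * x = x := by
      rw [← hF, ← mul_assoc, A.idem_mul_idem_of_subset Finset.subset_union_left]
    have h2 : A.idem (F ∪ G) * y = y := by
      rw [← hG, ← mul_assoc, A.idem_mul_idem_of_subset Finset.subset_union_right]
    rw [mul_add, h1, h2]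
  · intro i j d b _
    exact ⟨{i}, by rw [← mul_assoc, ← mul_assoc,
      A.idem_mul_one (Finset.mem_singleton_self i)]⟩

/-! ### Submodules, quotients and subquotients -/

section Subquotients

variable {k : Type uk} [Field k] {I : Type uI} {A : GAlg.{uk, uI, uA} k I}

/-- A graded submodule. -/
structure GSub (V : GMod.{uk, uI, uA, uV} A) where
  toSubmodule : Submodule k V
  act_mem : ∀ (a : A) {v : V}, v ∈ toSubmodule → V.act a v ∈ toSubmodule
  homog : IsHomog V.deg toSubmodule

namespace GSub

variable {V : GMod.{uk, uI, uA, uV} A}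

/-- A graded submodule, viewed as a graded module. -/
def toGMod (N : GSub V) : GMod.{uk, uI, uA, uV} A where
  carrier := N.toSubmodule
  act :=
    { toFun := fun a => (V.act a).restrict fun _ hv => N.act_mem a hv
      map_add' := fun a b => by
        ext v
        simp
      map_smul' := fun c a => by
        ext v
        simp }
  act_mul := fun a b v => Subtype.ext (V.act_mul a b v)
  deg := fun d => (V.deg d).comap N.toSubmodule.subtype
  isInternal_deg := isInternal_sub V.isInternal_deg N.homog
  act_mem_deg := fun ha hv => V.act_mem_deg ha hv
  span_weight := by
    apply GMod.span_weight_of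
    intro v
    obtain ⟨F, hF⟩ := V.exists_idem v.1
    exact ⟨F, Subtype.ext hF⟩

/-- The inclusion of a graded submodule. -/
def incl (N : GSub V) : N.toGMod →ₗ[k] V := N.toSubmodule.subtype

/-- The quotient of a graded module by a graded submodule. -/
def quot (N : GSub V) : GMod.{uk, uI, uA, uV} A where
  carrier := V ⧸ N.toSubmodule
  act :=
    { toFun := fun a => N.toSubmodule.mapQ N.toSubmodule (V.act a) fun _ hv => N.act_mem a hv
      map_add' := fun a b => by
        refine Submodule.linearMap_qext _ (LinearMap.ext fun x => ?_)
        exact congrArg N.toSubmodule.mkQ (LinearMap.congr_fun (V.act.map_add a b) x)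
      map_smul' := fun c a => by
        refine Submodule.linearMap_qext _ (LinearMap.ext fun x => ?_)
        exact congrArg N.toSubmodule.mkQ (LinearMap.congr_fun (V.act.map_smul c a) x) }
  act_mul := fun a b v => by
    obtain ⟨v, rfl⟩ := N.toSubmodule.mkQ_surjective v
    exact congrArg N.toSubmodule.mkQ (V.act_mul a b v)
  deg := fun d => (V.deg d).map N.toSubmodule.mkQ
  isInternal_deg := isInternal_quot V.isInternal_deg N.homog
  act_mem_deg := by
    rintro m n a _ ha ⟨v, hv, rfl⟩
    exact ⟨V.act a v, V.act_mem_deg ha hv, rfl⟩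
  span_weight := by
    apply GMod.span_weight_of
    intro v
    obtain ⟨v, rfl⟩ := N.toSubmodule.mkQ_surjective v
    obtain ⟨F, hF⟩ := V.exists_idem v
    exact ⟨F, congrArg N.toSubmodule.mkQ hF⟩

/-- The quotient map `V → V / N`. -/
def proj (N : GSub V) : V →ₗ[k] N.quot := N.toSubmodule.mkQ

/-- For `N ⊆ P`, the submodule `N` of the module `P`. -/
def inside (N P : GSub V) (h : N.toSubmodule ≤ P.toSubmodule) : GSub P.toGMod where
  toSubmodule := N.toSubmodule.comap P.toSubmodule.subtype
  act_mem := fun a _ hv => N.act_mem a hv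
  homog := by
    rintro ⟨v, hv⟩ hvN
    have key : ∃ hw : v ∈ P.toSubmodule, (⟨v, hw⟩ : P.toSubmodule) ∈
        ⨆ d, N.toSubmodule.comap P.toSubmodule.subtype ⊓
          (V.deg d).comap P.toSubmodule.subtype := by
      refine Submodule.iSup_induction (fun d => N.toSubmodule ⊓ V.deg d)
        (motive := fun w => ∃ hw : w ∈ P.toSubmodule, (⟨w, hw⟩ : P.toSubmodule) ∈
          ⨆ d, N.toSubmodule.comap P.toSubmodule.subtype ⊓
            (V.deg d).comap P.toSubmodule.subtype) (N.homog hvN) ?_ ?_ ?_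
      · intro d x hx
        exact ⟨h hx.1, Submodule.mem_iSup_of_mem d ⟨hx.1, hx.2⟩⟩
      · exact ⟨Submodule.zero_mem _, Submodule.zero_mem _⟩
      · rintro x y ⟨hx, hx'⟩ ⟨hy, hy'⟩
        exact ⟨Submodule.add_mem _ hx hy, Submodule.add_mem _ hx' hy'⟩
    exact key.2

/-- The subquotient `P / N` for `N ⊆ P ⊆ V`. -/
def subquot (N P : GSub V) (h : N.toSubmodule ≤ P.toSubmodule) : GMod.{uk, uI, uA, uV} A :=
  (N.inside P h).quot

end GSub

end Subquotients

/-! ### Inflation, truncation, and the adjoints of truncation -/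

section Functors

variable {k : Type uk} [Field k] {I : Type uI} {A : GAlg.{uk, uI, uA} k I}

/-- An `A / J`-module viewed as an `A`-module. -/
def inflate (J : A.GIdeal) (W : GMod.{uk, uI, uA, uV} (A.quot J)) :
    GMod.{uk, uI, uA, uV} A where
  carrier := W
  act :=
    { toFun := fun a => W.act (A.quotMap J a)
      map_add' := fun a b => (congrArg W.act ((A.quotMap J).map_add a b)).trans
        (W.act.map_add _ _)
      map_smul' := fun c a => (congrArg W.act ((A.quotMap J).map_smul c a)).trans
        (W.act.map_smul _ _) }
  act_mul := fun a b v => W.act_mul (A.quotMap J a) (A.quotMap J b) v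
  deg := W.deg
  isInternal_deg := W.isInternal_deg
  act_mem_deg := fun ha hv => W.act_mem_deg ⟨_, ha, rfl⟩ hv
  span_weight := W.span_weight

/-- The truncation `j V = e V`, an `e A e`-module, where `e = ∑_{i ∈ T} 1_i`. -/
def trunc (T : Finset I) (V : GMod.{uk, uI, uA, uV} A) :
    GMod.{uk, uI, uA, uV} (A.corner T) where
  carrier := LinearMap.eqLocus (V.act (A.idem T)) LinearMap.id
  act :=
    { toFun := fun a => (V.act (A.cornerIncl T a)).restrict (by
        intro v _
        change V.act (A.idem T) (V.act (A.cornerIncl T a) v) = V.act (A.cornerIncl T a) v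
        rw [← V.act_mul, (GAlg.cornerIncl_prop a).1])
      map_add' := fun a b => by
        ext v
        simp
      map_smul' := fun c a => by
        ext v
        simp }
  act_mul := fun a b v => Subtype.ext (V.act_mul (A.cornerIncl T a) (A.cornerIncl T b) v)
  deg := fun d => (V.deg d).comap (LinearMap.eqLocus (V.act (A.idem T)) LinearMap.id).subtype
  isInternal_deg := by
    refine isInternal_sub V.isInternal_deg
      (isHomog_of_proj V.isInternal_deg (V.act (A.idem T)) ?_ ?_ ?_)
    · intro v
      change V.act (A.idem T) (V.act (A.idem T) v) = V.act (A.idem T) v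
      rw [← V.act_mul, A.idem_mul_idem]
    · exact fun v hv => hv
    · intro d v hv
      simpa using V.act_mem_deg (A.idem_mem_deg T) hv
  act_mem_deg := fun ha hv => V.act_mem_deg ha hv
  span_weight := by
    apply GMod.span_weight_of
    rintro ⟨v, hv⟩
    refine ⟨Finset.univ, Subtype.ext ?_⟩
    have h1 : A.cornerIncl T ((A.corner T).idem Finset.univ) = A.idem T := by
      unfold GAlg.idem
      rw [map_sum]
      exact Finset.sum_coe_sort T A.one
    change V.act (A.cornerIncl T ((A.corner T).idem Finset.univ)) v = v
    rw [h1]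
    exact hv

/-- The inclusion `e V → V`. -/
def truncIncl (T : Finset I) (V : GMod.{uk, uI, uA, uV} A) : trunc T V →ₗ[k] V :=
  (LinearMap.eqLocus (V.act (A.idem T)) LinearMap.id).subtype

variable (T : Finset I)

/-- The relations `x b ⊗ w = x ⊗ b w` (`x ∈ A e`, `b ∈ e A e`, `w ∈ W`) defining the tensor
product `A e ⊗_{e A e} W` as a quotient of `A e ⊗_k W`. -/
def balanced (W : GMod.{uk, uI, uA, uV} (A.corner T)) :
    Submodule k (A.leftIdeal T ⊗[k] W) :=
  Submodule.span k {z | ∃ x b w,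
    z = (A.leftIdealMulCorner T b x) ⊗ₜ[k] w - x ⊗ₜ[k] (W.act b w)}

theorem balanced_homog (W : GMod.{uk, uI, uA, uV} (A.corner T)) :
    IsHomog (tensorDeg (fun d => (A.deg d).comap (A.leftIdeal T).subtype) W.deg)
      (balanced T W) := by
  apply isHomog_of_span
  rintro _ ⟨x, b, w, rfl⟩
  refine homog_induction (A.isInternal_leftIdeal T) (P := fun x =>
    A.leftIdealMulCorner T b x ⊗ₜ[k] w - x ⊗ₜ[k] (W.act b w) ∈ _) ?_ ?_ ?_ x
  · have : A.leftIdealMulCorner T b 0 = 0 := Subtype.ext (zero_mul _)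
    simp [this]
  · intro x y hx hy
    have : A.leftIdealMulCorner T b (x + y) =
      A.leftIdealMulCorner T b x + A.leftIdealMulCorner T b y := Subtype.ext (add_mul _ _ _)
    rw [this, TensorProduct.add_tmul, TensorProduct.add_tmul, add_sub_add_comm]
    exact Submodule.add_mem _ hx hy
  intro c x hx
  refine homog_induction (A.corner T).isInternal_deg (P := fun b =>
    A.leftIdealMulCorner T b x ⊗ₜ[k] w - x ⊗ₜ[k] (W.act b w) ∈ _) ?_ ?_ ?_ b
  · have : A.leftIdealMulCorner T 0 x = 0 := Subtype.ext (mul_zero _)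
    simp [this]
  · intro a b ha hb
    have : A.leftIdealMulCorner T (a + b) x =
      A.leftIdealMulCorner T a x + A.leftIdealMulCorner T b x := Subtype.ext (mul_add _ _ _)
    rw [this, map_add, LinearMap.add_apply, TensorProduct.add_tmul, TensorProduct.tmul_add,
      add_sub_add_comm]
    exact Submodule.add_mem _ ha hb
  intro m b hb
  refine homog_induction W.isInternal_deg (P := fun w =>
    A.leftIdealMulCorner T b x ⊗ₜ[k] w - x ⊗ₜ[k] (W.act b w) ∈ _) ?_ ?_ ?_ w
  · simp
  · intro v w hv hw
    rw [map_add, TensorProduct.tmul_add, TensorProduct.tmul_add, add_sub_add_comm]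
    exact Submodule.add_mem _ hv hw
  intro n w hw
  refine Submodule.mem_iSup_of_mem (c + m + n)
    ⟨Submodule.subset_span ⟨x, b, w, rfl⟩, Submodule.sub_mem _ ?_ ?_⟩
  · exact Submodule.subset_span ⟨c + m, n, _, w, rfl, A.mul_mem_deg hx hb, hw, rfl⟩
  · exact Submodule.subset_span ⟨c, m + n, x, _, (add_assoc c m n).symm, hx,
      W.act_mem_deg hb hw, rfl⟩

/-- The action of `A` on `A e ⊗_{e A e} W` by left multiplication on the first factor. -/
def shriekAct (W : GMod.{uk, uI, uA, uV} (A.corner T)) :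
    A →ₗ[k] ((A.leftIdeal T ⊗[k] W) ⧸ balanced T W) →ₗ[k]
      ((A.leftIdeal T ⊗[k] W) ⧸ balanced T W) where
  toFun := fun a => (balanced T W).mapQ (balanced T W)
    (LinearMap.rTensor W (A.leftIdealMul T a)) (by
      refine Submodule.span_le.2 ?_
      rintro _ ⟨x, b, w, rfl⟩
      refine Submodule.subset_span ⟨A.leftIdealMul T a x, b, w, ?_⟩
      have : A.leftIdealMul T a (A.leftIdealMulCorner T b x) =
        A.leftIdealMulCorner T b (A.leftIdealMul T a x) :=
          Subtype.ext (mul_assoc _ _ _).symm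
      rw [map_sub, LinearMap.rTensor_tmul, LinearMap.rTensor_tmul, this])
  map_add' := fun a b => by
    refine Submodule.linearMap_qext _ (LinearMap.ext fun x => ?_)
    refine congrArg (balanced T W).mkQ ?_
    rw [map_add, LinearMap.rTensor_add, LinearMap.add_apply]
  map_smul' := fun c a => by
    refine Submodule.linearMap_qext _ (LinearMap.ext fun x => ?_)
    refine congrArg (balanced T W).mkQ ?_
    rw [map_smul, LinearMap.rTensor_smul]
    rfl

theorem shriekAct_mk (W : GMod.{uk, uI, uA, uV} (A.corner T)) (a : A)
    (z : A.leftIdeal T ⊗[k] W) :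
    shriekAct T W a ((balanced T W).mkQ z) =
      (balanced T W).mkQ (LinearMap.rTensor W (A.leftIdealMul T a) z) := rfl

/-- The grading of `A e ⊗_{e A e} W`. -/
def shriekDeg (W : GMod.{uk, uI, uA, uV} (A.corner T)) (n : ℤ) :
    Submodule k ((A.leftIdeal T ⊗[k] W) ⧸ balanced T W) :=
  (tensorDeg (fun d => (A.deg d).comap (A.leftIdeal T).subtype) W.deg n).map (balanced T W).mkQ

theorem shriekAct_mul (W : GMod.{uk, uI, uA, uV} (A.corner T)) (a b : A)
    (v : (A.leftIdeal T ⊗[k] W) ⧸ balanced T W) :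
    shriekAct T W (a * b) v = shriekAct T W a (shriekAct T W b v) := by
  obtain ⟨v, rfl⟩ := (balanced T W).mkQ_surjective v
  have : A.leftIdealMul T (a * b) = A.leftIdealMul T a ∘ₗ A.leftIdealMul T b :=
    LinearMap.ext fun x => Subtype.ext (mul_assoc _ _ _)
  rw [shriekAct_mk, shriekAct_mk, shriekAct_mk, this, LinearMap.rTensor_comp_apply]

theorem shriekAct_mem_deg (W : GMod.{uk, uI, uA, uV} (A.corner T)) {m n : ℤ} {a : A}
    {v : (A.leftIdeal T ⊗[k] W) ⧸ balanced T W} (ha : a ∈ A.deg m)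
    (hv : v ∈ shriekDeg T W n) : shriekAct T W a v ∈ shriekDeg T W (m + n) := by
  obtain ⟨z, hz, rfl⟩ := hv
  rw [shriekAct_mk]
  refine Submodule.mem_map_of_mem (f := (balanced T W).mkQ) ?_
  refine Submodule.span_induction (p := fun z _ => LinearMap.rTensor W (A.leftIdealMul T a) z ∈
    tensorDeg (fun d => (A.deg d).comap (A.leftIdeal T).subtype) W.deg (m + n)) ?_ ?_ ?_ ?_ hz
  · rintro _ ⟨c, d, x, w, rfl, hx, hw, rfl⟩
    rw [LinearMap.rTensor_tmul]
    exact Submodule.subset_span ⟨m + c, d, A.leftIdealMul T a x, w, add_assoc m c d,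
      A.mul_mem_deg ha hx, hw, rfl⟩
  · rw [map_zero]; exact Submodule.zero_mem _
  · intro x y _ _ hx hy
    rw [map_add]; exact Submodule.add_mem _ hx hy
  · intro c x _ hx
    rw [map_smul]; exact Submodule.smul_mem _ c hx

theorem shriek_span_weight (W : GMod.{uk, uI, uA, uV} (A.corner T)) :
    Submodule.span k {v | ∃ i w, v = shriekAct T W (A.one i) w} = ⊤ := by
  rw [Submodule.eq_top_iff']
  intro z
  obtain ⟨z, rfl⟩ := (balanced T W).mkQ_surjective z
  induction z using TensorProduct.induction_on with
  | zero => rw [map_zero]; exact Submodule.zero_mem _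
  | add x y hx hy => rw [map_add]; exact Submodule.add_mem _ hx hy
  | tmul x w =>
    obtain ⟨F, hF⟩ := A.exists_idem_mul (x : A)
    have h1 : ∑ i ∈ F, A.leftIdealMul T (A.one i) x = x := by
      rw [← GMod.act_idem]
      exact Subtype.ext hF
    rw [← h1, TensorProduct.sum_tmul, map_sum]
    refine Submodule.sum_mem _ fun i _ => ?_
    refine Submodule.subset_span ⟨i, (balanced T W).mkQ (x ⊗ₜ[k] w), ?_⟩
    rw [shriekAct_mk, LinearMap.rTensor_tmul]

/-- The functor `j_! = A e ⊗_{e A e} -` on objects. -/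
def jShriek (W : GMod.{uk, uI, uA, uV} (A.corner T)) : GMod.{uk, uI, uA, max uA uV} A where
  carrier := (A.leftIdeal T ⊗[k] W) ⧸ balanced T W
  act := shriekAct T W
  act_mul := shriekAct_mul T W
  deg := shriekDeg T W
  isInternal_deg := isInternal_quot
    (isInternal_tensor (A.isInternal_leftIdeal T) W.isInternal_deg) (balanced_homog T W)
  act_mem_deg := shriekAct_mem_deg T W
  span_weight := shriek_span_weight T W

/-- The class of `x ⊗ w` in `A e ⊗_{e A e} W`. -/
def jShriekMk (W : GMod.{uk, uI, uA, uV} (A.corner T)) (x : A.leftIdeal T) (w : W) :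
    jShriek T W :=
  (balanced T W).mkQ (x ⊗ₜ[k] w)

/-- The homogeneous elements of degree `d` in `Hom_{e A e}(e A 1_i, W)`.  A map on `e A 1_i` is
extended to `e A` by zero on `e A 1_j` for `j ≠ i`, i.e. by `f x = f (x 1_i)`. -/
def gradedHom (W : GMod.{uk, uI, uA, uV} (A.corner T)) (i : I) (d : ℤ) :
    Set (A.rightIdeal T →ₗ[k] W) :=
  {f | (∀ b x, f (A.rightIdealCornerMul T b x) = W.act b (f x)) ∧
    (∀ x, f (A.rightIdealMul T (A.one i) x) = f x) ∧
    ∀ n, ∀ x : A.rightIdeal T, (x : A) ∈ A.deg n → f x ∈ W.deg (n + d)}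

/-- `⨁_i Hom_{e A e}(e A 1_i, W)`, as an (internally direct) sum of subspaces of
`Hom_k(e A, W)`; here `Hom` is the direct sum of its homogeneous parts. -/
def jStarSub (W : GMod.{uk, uI, uA, uV} (A.corner T)) :
    Submodule k (A.rightIdeal T →ₗ[k] W) :=
  Submodule.span k {f | ∃ i d, f ∈ gradedHom T W i d}

theorem comp_mem_gradedHom {W : GMod.{uk, uI, uA, uV} (A.corner T)} {i j l : I} {d m : ℤ}
    {f : A.rightIdeal T →ₗ[k] W} (hf : f ∈ gradedHom T W i d) {b : A} (hb : b ∈ A.deg m) :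
    f ∘ₗ A.rightIdealMul T (A.one j * b * A.one l) ∈ gradedHom T W j (m + d) := by
  refine ⟨?_, ?_, ?_⟩
  · intro c x
    rw [LinearMap.comp_apply, LinearMap.comp_apply, ← hf.1]
    exact congrArg f (Subtype.ext (mul_assoc _ _ _))
  · intro x
    refine congrArg f (Subtype.ext ?_)
    change (x : A) * A.one j * (A.one j * b * A.one l) = (x : A) * (A.one j * b * A.one l)
    rw [mul_assoc, ← mul_assoc (A.one j), ← mul_assoc (A.one j), A.one_mul_one]
  · intro n x hx
    rw [← add_assoc]
    refine hf.2.2 (n + m) _ ?_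
    have := A.mul_mem_deg hx
      (A.mul_mem_deg (A.mul_mem_deg (A.one_mem_deg j) hb) (A.one_mem_deg l))
    rwa [zero_add, add_zero] at this

theorem comp_mem_jStarSub {W : GMod.{uk, uI, uA, uV} (A.corner T)} (a : A)
    {f : A.rightIdeal T →ₗ[k] W} (hf : f ∈ jStarSub T W) :
    f ∘ₗ A.rightIdealMul T a ∈ jStarSub T W := by
  refine Submodule.span_induction
    (p := fun f _ => f ∘ₗ A.rightIdealMul T a ∈ jStarSub T W) ?_ ?_ ?_ ?_ hf
  · rintro f ⟨i, d, hf⟩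
    refine A.peirce_induction (P := fun a => f ∘ₗ A.rightIdealMul T a ∈ jStarSub T W)
      (by simp) ?_ ?_ a
    · intro a b ha hb
      rw [map_add, LinearMap.comp_add]
      exact Submodule.add_mem _ ha hb
    · intro j l m b hb
      exact Submodule.subset_span ⟨j, m + d, comp_mem_gradedHom T hf hb⟩
  · simp
  · intro f g _ _ hf hg
    rw [LinearMap.add_comp]
    exact Submodule.add_mem _ hf hg
  · intro c f _ hf
    rw [LinearMap.smul_comp]
    exact Submodule.smul_mem _ c hf

/-- The maps `e A → W` of degree `d`. -/
def homDeg (W : GMod.{uk, uI, uA, uV} (A.corner T)) (d : ℤ) :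
    Submodule k (A.rightIdeal T →ₗ[k] W) where
  carrier := {f | ∀ n, ∀ x : A.rightIdeal T, (x : A) ∈ A.deg n → f x ∈ W.deg (n + d)}
  zero_mem' := fun _ _ _ => Submodule.zero_mem _
  add_mem' := fun hf hg n x hx => Submodule.add_mem _ (hf n x hx) (hg n x hx)
  smul_mem' := fun c _ hf n x hx => Submodule.smul_mem _ c (hf n x hx)

theorem isInternal_rightIdeal :
    DirectSum.IsInternal fun d => (A.deg d).comap (A.rightIdeal T).subtype := by
  refine isInternal_sub A.isInternal_deg
    (isHomog_of_proj A.isInternal_deg (LinearMap.mulLeft k (A.idem T)) ?_ ?_ ?_)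
  · intro a
    change A.idem T * (A.idem T * a) = A.idem T * a
    rw [← mul_assoc, A.idem_mul_idem]
  · exact fun a ha => ha
  · intro d a ha
    simpa using A.mul_mem_deg (A.idem_mem_deg T) ha

/-- The functor `j_* = ⨁_i Hom_{e A e}(e A 1_i, -)` on objects, with action
`(a f)(x) = f(x a)`. -/
def jStar (W : GMod.{uk, uI, uA, uV} (A.corner T)) : GMod.{uk, uI, uA, max uA uV} A where
  carrier := jStarSub T W
  act :=
    { toFun := fun a => (LinearMap.lcomp k W (A.rightIdealMul T a)).restrict
        fun _ hf => comp_mem_jStarSub T a hf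
      map_add' := fun a b => by
        ext f x
        exact (congrArg f.1 (LinearMap.congr_fun ((A.rightIdealMul T).map_add a b) x)).trans
          (f.1.map_add _ _)
      map_smul' := fun c a => by
        ext f x
        exact (congrArg f.1 (LinearMap.congr_fun ((A.rightIdealMul T).map_smul c a) x)).trans
          (f.1.map_smul _ _) }
  act_mul := fun a b f => by
    refine Subtype.ext (LinearMap.ext fun x => ?_)
    exact congrArg f.1 (Subtype.ext (mul_assoc _ _ _).symm)
  deg := fun d => (homDeg T W d).comap (jStarSub T W).subtype
  isInternal_deg := by
    obtain ⟨δ, hδ⟩ := exists_comp W.isInternal_deg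
    refine isInternal_of_detect
      (α := {p : ℤ × A.rightIdeal T // (p.2 : A) ∈ A.deg p.1}) _ ?_
      (fun p => LinearMap.applyₗ p.1.2 ∘ₗ (jStarSub T W).subtype)
      (fun p => Finsupp.lmapDomain _ k (fun d => d - p.1.1) ∘ₗ δ ∘ₗ
        LinearMap.applyₗ p.1.2 ∘ₗ (jStarSub T W).subtype) ?_ ?_
    · rintro ⟨f, hf⟩
      refine Submodule.span_induction (p := fun f hf => (⟨f, hf⟩ : jStarSub T W) ∈
        ⨆ d, (homDeg T W d).comap (jStarSub T W).subtype) ?_ ?_ ?_ ?_ hf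
      · rintro f ⟨i, d, hf⟩
        exact Submodule.mem_iSup_of_mem d hf.2.2
      · exact Submodule.zero_mem _
      · intro f g _ _ hf hg
        exact Submodule.add_mem _ hf hg
      · intro c f _ hf
        exact Submodule.smul_mem _ c hf
    · rintro ⟨⟨n, x⟩, hx⟩ d f hf
      have h1 : f.1 x ∈ W.deg (n + d) := hf n x hx
      simp [hδ _ _ h1, Finsupp.mapDomain_single]
    · intro f hf
      refine Subtype.ext (LinearMap.ext fun x => ?_)
      refine homog_induction (isInternal_rightIdeal T) (P := fun x => f.1 x = 0)
        (map_zero _) ?_ ?_ x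
      · intro x y hx hy
        rw [map_add, hx, hy, add_zero]
      · intro n x hx
        exact hf ⟨(n, x), hx⟩
  act_mem_deg := by
    intro m d a f ha hf n x hx
    rw [← add_assoc]
    exact hf (n + m) _ (A.mul_mem_deg hx ha)
  span_weight := by
    rw [Submodule.eq_top_iff']
    rintro ⟨f, hf⟩
    refine Submodule.span_induction (p := fun f hf => (⟨f, hf⟩ : jStarSub T W) ∈
      Submodule.span k _) ?_ ?_ ?_ ?_ hf
    · rintro f ⟨i, d, hf⟩
      refine Submodule.subset_span ⟨i, ⟨f, Submodule.subset_span ⟨i, d, hf⟩⟩, ?_⟩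
      exact Subtype.ext (LinearMap.ext fun x => (hf.2.1 x).symm)
    · exact Submodule.zero_mem _
    · intro f g _ _ hf hg
      exact Submodule.add_mem _ hf hg
    · intro c f _ hf
      exact Submodule.smul_mem _ c hf

/-- Evaluation of an element of `j_* W` at an element of `e A`. -/
def jStarEval (W : GMod.{uk, uI, uA, uV} (A.corner T)) (f : jStar T W) (x : A.rightIdeal T) :
    W :=
  f.1 x

/-- The multiplication map `A e ⊗_k e V → V`. -/
def counitAux (V : GMod.{uk, uI, uA, uV} A) : A.leftIdeal T ⊗[k] trunc T V →ₗ[k] V :=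
  TensorProduct.lift ((V.act ∘ₗ (A.leftIdeal T).subtype).compl₂ (truncIncl T V))

theorem counitAux_tmul (V : GMod.{uk, uI, uA, uV} A) (x : A.leftIdeal T) (v : trunc T V) :
    counitAux T V (x ⊗ₜ[k] v) = V.act (x : A) (truncIncl T V v) := rfl

theorem counitAux_balanced (V : GMod.{uk, uI, uA, uV} A) :
    balanced T (trunc T V) ≤ LinearMap.ker (counitAux T V) := by
  refine Submodule.span_le.2 ?_
  rintro _ ⟨x, b, w, rfl⟩
  change counitAux T V _ = 0
  rw [map_sub, sub_eq_zero, counitAux_tmul, counitAux_tmul]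
  exact V.act_mul (x : A) (A.cornerIncl T b) (truncIncl T V w)

theorem counitAux_act (V : GMod.{uk, uI, uA, uV} A) (a : A)
    (z : A.leftIdeal T ⊗[k] trunc T V) :
    counitAux T V (LinearMap.rTensor _ (A.leftIdealMul T a) z) = V.act a (counitAux T V z) := by
  induction z using TensorProduct.induction_on with
  | zero => rw [map_zero, map_zero, map_zero]
  | add x y hx hy => rw [map_add, map_add, map_add, map_add, hx, hy]
  | tmul x w =>
    rw [LinearMap.rTensor_tmul, counitAux_tmul, counitAux_tmul]
    exact V.act_mul a (x : A) (truncIncl T V w)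

theorem counitAux_deg (V : GMod.{uk, uI, uA, uV} A) (n : ℤ)
    {z : A.leftIdeal T ⊗[k] trunc T V}
    (hz : z ∈ tensorDeg (fun d => (A.deg d).comap (A.leftIdeal T).subtype) (trunc T V).deg n) :
    counitAux T V z ∈ V.deg n := by
  refine Submodule.span_induction (p := fun z _ => counitAux T V z ∈ V.deg n) ?_ ?_ ?_ ?_ hz
  · rintro _ ⟨c, d, x, w, rfl, hx, hw, rfl⟩
    exact V.act_mem_deg hx hw
  · rw [map_zero]; exact Submodule.zero_mem _
  · intro x y _ _ hx hy
    rw [map_add]; exact Submodule.add_mem _ hx hy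
  · intro c x _ hx
    rw [map_smul]; exact Submodule.smul_mem _ c hx

/-- The counit `j_! j V → V`, i.e. the multiplication map `A e ⊗_{e A e} e V → V`,
`x ⊗ v ↦ x v`. -/
def counit (V : GMod.{uk, uI, uA, uV} A) : GMod.Hom (jShriek T (trunc T V)) V where
  toLin := (balanced T (trunc T V)).liftQ (counitAux T V) (counitAux_balanced T V)
  map_act := by
    intro a z
    obtain ⟨z, rfl⟩ := (balanced T (trunc T V)).mkQ_surjective z
    exact counitAux_act T V a z
  map_deg := by
    rintro n _ ⟨z, hz, rfl⟩
    exact counitAux_deg T V n hz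

theorem counit_apply (V : GMod.{uk, uI, uA, uV} A) (x : A.leftIdeal T) (v : trunc T V) :
    (counit T V).toLin (jShriekMk T (trunc T V) x v) = V.act (x : A) (truncIncl T V v) := rfl

/-- The universal property of the counit: every homomorphism `j_! W → V` is
`x ⊗ w ↦ x (g w)` for a unique homomorphism `g : W → j V`. -/
theorem counit_universal (V : GMod.{uk, uI, uA, uV} A) (W : GMod.{uk, uI, uA, uW} (A.corner T))
    (f : GMod.Hom (jShriek T W) V) :
    ∃! g : GMod.Hom W (trunc T V), ∀ x w, f.toLin (jShriekMk T W x w) =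
      (counit T V).toLin (jShriekMk T (trunc T V) x (g.toLin w)) := by
  let e : A.leftIdeal T := ⟨A.idem T, A.idem_mul_idem T⟩
  have hx : ∀ (x : A.leftIdeal T) (w : W),
      f.toLin (jShriekMk T W x w) = V.act (x : A) (f.toLin (jShriekMk T W e w)) := by
    intro x w
    rw [← f.map_act]
    refine congrArg f.toLin (congrArg (fun y => jShriekMk T W y w) (Subtype.ext ?_))
    exact (show (x : A) * A.idem T = x from x.2).symm
  let l : W →ₗ[k] V := f.toLin ∘ₗ (balanced T W).mkQ ∘ₗ TensorProduct.mk k _ W e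
  have hl : ∀ w, l w ∈ LinearMap.eqLocus (V.act (A.idem T)) LinearMap.id :=
    fun w => (hx e w).symm
  refine ⟨⟨l.codRestrict _ hl, ?_, ?_⟩, ?_, ?_⟩
  · intro b w
    refine Subtype.ext ?_
    change f.toLin (jShriekMk T W e (W.act b w)) =
      V.act (A.cornerIncl T b) (f.toLin (jShriekMk T W e w))
    have h1 : jShriekMk T W e (W.act b w) =
        jShriekMk T W (A.leftIdealMulCorner T b e) w := by
      refine ((Submodule.Quotient.eq (balanced T W)).2 ?_).symm
      exact Submodule.subset_span ⟨e, b, w, rfl⟩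
    rw [h1, hx]
    refine congrArg (fun y => V.act y (f.toLin (jShriekMk T W e w))) ?_
    exact (GAlg.cornerIncl_prop b).1
  · intro d w hw
    exact f.map_deg d _ ⟨e ⊗ₜ[k] w, Submodule.subset_span
      ⟨0, d, e, w, zero_add d, A.idem_mem_deg T, hw, rfl⟩, rfl⟩
  · exact hx
  · rintro ⟨g, hg1, hg2⟩ hg
    have : g = l.codRestrict _ hl := by
      refine LinearMap.ext fun w => Subtype.ext ?_
      have h1 : f.toLin (jShriekMk T W e w) = V.act (A.idem T) (truncIncl T V (g w)) := hg e w
      exact (h1.trans (g w).2).symm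
    subst this
    rfl

/-- The map `e A → e V`, `x ↦ x v`. -/
def unitAux (V : GMod.{uk, uI, uA, uV} A) : V →ₗ[k] A.rightIdeal T →ₗ[k] trunc T V :=
  LinearMap.mk₂ k
    (fun v x => ⟨V.act (x : A) v, by
      change V.act (A.idem T) (V.act (x : A) v) = V.act (x : A) v
      rw [← V.act_mul, show A.idem T * (x : A) = x from x.2]⟩)
    (fun v w x => Subtype.ext (map_add _ v w))
    (fun c v x => Subtype.ext (map_smul _ c v))
    (fun v x y => Subtype.ext (LinearMap.congr_fun (V.act.map_add (x : A) (y : A)) v))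
    (fun c v x => Subtype.ext (LinearMap.congr_fun (V.act.map_smul c (x : A)) v))

theorem unitAux_mem (V : GMod.{uk, uI, uA, uV} A) (v : V) :
    unitAux T V v ∈ jStarSub T (trunc T V) := by
  obtain ⟨F, hF⟩ := V.exists_idem v
  rw [← hF, GMod.act_idem, map_sum]
  refine Submodule.sum_mem _ fun i _ => ?_
  refine homog_induction V.isInternal_deg (P := fun v => unitAux T V (V.act (A.one i) v) ∈
    jStarSub T (trunc T V)) (by simp) ?_ ?_ v
  · intro v w hv hw
    rw [map_add, map_add]
    exact Submodule.add_mem _ hv hw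
  · intro d v hv
    refine Submodule.subset_span ⟨i, d, ?_, ?_, ?_⟩
    · intro b x
      exact Subtype.ext (V.act_mul _ _ _)
    · intro x
      refine Subtype.ext ?_
      change V.act ((x : A) * A.one i) (V.act (A.one i) v) = V.act (x : A) (V.act (A.one i) v)
      rw [← V.act_mul, mul_assoc, A.one_mul_one, V.act_mul]
    · intro n x hx
      have h1 := V.act_mem_deg hx (V.act_mem_deg (A.one_mem_deg i) hv)
      rwa [zero_add] at h1

/-- The unit `V → j_* j V`, sending `v` to the map `x ↦ x v` on `e A`. -/
def unit (V : GMod.{uk, uI, uA, uV} A) : GMod.Hom V (jStar T (trunc T V)) where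
  toLin := (unitAux T V).codRestrict _ (unitAux_mem T V)
  map_act := by
    intro a v
    refine Subtype.ext (LinearMap.ext fun x => Subtype.ext ?_)
    exact (V.act_mul (x : A) a v).symm
  map_deg := fun d v hv n x hx => V.act_mem_deg hx hv

theorem unit_apply (V : GMod.{uk, uI, uA, uV} A) (v : V) (x : A.rightIdeal T) :
    truncIncl T V (jStarEval T (trunc T V) ((unit T V).toLin v) x) = V.act (x : A) v := rfl

theorem jStar_linear (W : GMod.{uk, uI, uA, uV} (A.corner T)) (f : jStar T W) (b : A.corner T)
    (x : A.rightIdeal T) :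
    jStarEval T W f (A.rightIdealCornerMul T b x) = W.act b (jStarEval T W f x) := by
  obtain ⟨f, hf⟩ := f
  refine Submodule.span_induction
    (p := fun f _ => f (A.rightIdealCornerMul T b x) = W.act b (f x)) ?_ ?_ ?_ ?_ hf
  · rintro f ⟨i, d, hf⟩
    exact hf.1 b x
  · exact (map_zero (W.act b)).symm
  · intro f g _ _ hf hg
    rw [LinearMap.add_apply, LinearMap.add_apply, map_add, hf, hg]
  · intro c f _ hf
    rw [LinearMap.smul_apply, LinearMap.smul_apply, map_smul, hf]

/-- The universal property of the unit: every homomorphism `V → j_* W` sends `v` to the map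
`x ↦ g (x v)` on `e A`, for a unique homomorphism `g : j V → W`. -/
theorem unit_universal (V : GMod.{uk, uI, uA, uV} A) (W : GMod.{uk, uI, uA, uW} (A.corner T))
    (f : GMod.Hom V (jStar T W)) :
    ∃! g : GMod.Hom (trunc T V) W, ∀ v x, jStarEval T W (f.toLin v) x =
      g.toLin (jStarEval T (trunc T V) ((unit T V).toLin v) x) := by
  let e : A.rightIdeal T := ⟨A.idem T, A.idem_mul_idem T⟩
  have hact : ∀ (a : A) (v : V), jStarEval T W (f.toLin (V.act a v)) e =
      jStarEval T W (f.toLin v) (A.rightIdealMul T a e) := by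
    intro a v
    rw [f.map_act]
    rfl
  let l : trunc T V →ₗ[k] W :=
    LinearMap.applyₗ e ∘ₗ (jStarSub T W).subtype ∘ₗ f.toLin ∘ₗ truncIncl T V
  refine ⟨⟨l, ?_, ?_⟩, ?_, ?_⟩
  · intro b u
    change jStarEval T W (f.toLin (V.act (A.cornerIncl T b) (truncIncl T V u))) e =
      W.act b (jStarEval T W (f.toLin (truncIncl T V u)) e)
    rw [hact, ← jStar_linear]
    refine congrArg (jStarEval T W (f.toLin (truncIncl T V u))) (Subtype.ext ?_)
    exact (GAlg.cornerIncl_prop b).1.trans (GAlg.cornerIncl_prop b).2.symm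
  · intro d u hu
    have h1 := f.map_deg d _ hu 0 e (A.idem_mem_deg T)
    rwa [zero_add] at h1
  · intro v x
    refine ((hact (x : A) v).trans ?_).symm
    exact congrArg (jStarEval T W (f.toLin v)) (Subtype.ext x.2)
  · rintro ⟨g, hg1, hg2⟩ hg
    have : g = l := by
      refine LinearMap.ext fun u => ?_
      refine ((hg (truncIncl T V u) e).trans (congrArg g (Subtype.ext ?_))).symm
      exact u.2
    subst this
    rfl

/-- The submodule `A e V` of `V`. -/
def genSub (V : GMod.{uk, uI, uA, uV} A) : GSub V where
  toSubmodule := Submodule.span k {z | ∃ (a : A) (v : V), z = V.act a (V.act (A.idem T) v)}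
  act_mem := by
    intro c x hx
    refine Submodule.span_induction (p := fun x _ => V.act c x ∈ _) ?_ ?_ ?_ ?_ hx
    · rintro _ ⟨a, v, rfl⟩
      exact Submodule.subset_span ⟨c * a, v, (V.act_mul _ _ _).symm⟩
    · simp
    · intro x y _ _ hx hy
      rw [map_add]; exact Submodule.add_mem _ hx hy
    · intro r x _ hx
      rw [map_smul]; exact Submodule.smul_mem _ r hx
  homog := by
    apply isHomog_of_span
    rintro _ ⟨a, v, rfl⟩
    refine homog_induction A.isInternal_deg
      (P := fun a => V.act a (V.act (A.idem T) v) ∈ _) (by simp) ?_ ?_ a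
    · intro a b ha hb
      rw [map_add, LinearMap.add_apply]; exact Submodule.add_mem _ ha hb
    intro m a ha
    refine homog_induction V.isInternal_deg
      (P := fun v => V.act a (V.act (A.idem T) v) ∈ _) (by simp) ?_ ?_ v
    · intro v w hv hw
      rw [map_add, map_add]; exact Submodule.add_mem _ hv hw
    intro n v hv
    exact Submodule.mem_iSup_of_mem (m + (0 + n)) ⟨Submodule.subset_span ⟨a, v, rfl⟩,
      V.act_mem_deg ha (V.act_mem_deg (A.idem_mem_deg T) hv)⟩

/-- The submodule `{v ∈ V | e A v = 0}` of `V`. -/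
def annSub (V : GMod.{uk, uI, uA, uV} A) : GSub V where
  toSubmodule :=
    { carrier := {v | ∀ a : A, V.act (A.idem T * a) v = 0}
      zero_mem' := fun a => map_zero _
      add_mem' := fun hv hw a => by rw [map_add, hv a, hw a, add_zero]
      smul_mem' := fun c v hv a => by rw [map_smul, hv a, smul_zero] }
  act_mem := by
    intro b v hv a
    rw [← V.act_mul, mul_assoc]
    exact hv (a * b)
  homog := by
    refine isHomog_of_ker V.isInternal_deg
      (α := {p : ℤ × A // p.2 ∈ A.deg p.1}) (fun p => V.act (A.idem T * p.1.2))
      (fun p => p.1.1) ?_ ?_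
    · rintro ⟨⟨m, a⟩, ha⟩ d v hv
      have h1 := V.act_mem_deg (A.mul_mem_deg (A.idem_mem_deg T) ha) hv
      rwa [zero_add] at h1
    · intro v
      refine ⟨fun hv p => hv p.1.2, fun hv a => ?_⟩
      refine homog_induction A.isInternal_deg (P := fun a => V.act (A.idem T * a) v = 0)
        (by simp) ?_ ?_ a
      · intro a b ha hb
        rw [mul_add, map_add, LinearMap.add_apply, ha, hb, add_zero]
      · intro m a ha
        exact hv ⟨(m, a), ha⟩

end Functors

/-! ### Graded triangular bases -/

/-- The set `⋃_{s, t} X(s) × H(s, t) × Y(t)` of triples `(x, h, y)`, where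
`X(s) = ⋃_i X(i, s)` and `Y(t) = ⋃_j Y(t, j)`. -/
def triples {M I S : Type*} (X : I → S → Set M) (H : S → S → Set M) (Y : S → I → Set M) :
    Set (M × M × M) :=
  {p | ∃ s t, (∃ i, p.1 ∈ X i s) ∧ p.2.1 ∈ H s t ∧ ∃ j, p.2.2 ∈ Y t j}

/-- A graded triangular basis of `A` with special idempotents indexed by `S ⊆ I` and weight
poset `Λ`. -/
structure TriBasis {k : Type uk} [Field k] {I : Type uI} (A : GAlg.{uk, uI, uA} k I)
    (Λ : Type uL) [PartialOrder Λ] where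
  S : Set I
  wt : S → Λ
  lower_finite : ∀ l : Λ, (Set.Iic l).Finite
  finite_fiber : ∀ l : Λ, {s : S | wt s = l}.Finite
  X : I → S → Set A
  H : S → S → Set A
  Y : S → I → Set A
  X_mem : ∀ i s, ∀ x ∈ X i s, A.one i * x = x ∧ x * A.one s = x
  H_mem : ∀ s t, ∀ h ∈ H s t, A.one s * h = h ∧ h * A.one t = h
  Y_mem : ∀ t j, ∀ y ∈ Y t j, A.one t * y = y ∧ y * A.one j = y
  X_homog : ∀ i s, ∀ x ∈ X i s, ∃ d, x ∈ A.deg d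
  H_homog : ∀ s t, ∀ h ∈ H s t, ∃ d, h ∈ A.deg d
  Y_homog : ∀ t j, ∀ y ∈ Y t j, ∃ d, y ∈ A.deg d
  linearIndependent :
    LinearIndependent k (fun p : triples X H Y => (p.1.1 * p.1.2.1 * p.1.2.2 : A))
  span_eq_top :
    Submodule.span k (Set.range fun p : triples X H Y => (p.1.1 * p.1.2.1 * p.1.2.2 : A)) = ⊤
  X_self : ∀ s : S, X s s = {A.one s}
  Y_self : ∀ s : S, Y s s = {A.one s}
  X_lt : ∀ s t : S, s ≠ t → (X s t).Nonempty → wt t < wt s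
  H_eq : ∀ s t : S, s ≠ t → (H s t).Nonempty → wt s = wt t
  Y_lt : ∀ s t : S, s ≠ t → (Y s t).Nonempty → wt s < wt t
  finite_support : ∀ i ∉ S, {s : S | (X i s ∪ Y s i).Nonempty}.Finite

namespace TriBasis

variable {k : Type uk} [Field k] {I : Type uI} {A : GAlg.{uk, uI, uA} k I}
  {Λ : Type uL} [PartialOrder Λ] (B : TriBasis A Λ)

/-- The finite set `S_Γ` of special indices with weight in the finite set `Γ`. -/
noncomputable def indices (Γ : Finset Λ) : Finset I :=
  (((Γ.finite_toSet.biUnion fun l _ => B.finite_fiber l).image Subtype.val)).toFinset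

theorem mem_indices (Γ : Finset Λ) (i : I) :
    i ∈ B.indices Γ ↔ ∃ h : i ∈ B.S, B.wt ⟨i, h⟩ ∈ Γ := by
  simp [indices]

/-- The ideal of `A` generated by the idempotents `e_μ` with `μ ≱ λ`, where
`e_μ = ∑_{s ∈ S_μ} 1_s`. -/
def idealGe (l : Λ) : A.GIdeal :=
  A.idealSpan {x | ∃ m : Λ, ¬ l ≤ m ∧ x = A.idem (B.indices {m})} (by
    rintro _ ⟨m, _, rfl⟩
    exact A.idem_mem_deg _)

/-- The algebra `A_{≥ λ}`. -/
def algGe (l : Λ) : GAlg.{uk, uI, uA} k I := A.quot (B.idealGe l)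

/-- The algebra `A_λ = e_λ A_{≥ λ} e_λ`. -/
noncomputable def algAt (l : Λ) : GAlg.{uk, uI, uA} k (B.indices {l}) :=
  (B.algGe l).corner (B.indices {l})

/-- Standardization `A_λ-gmod → A_{≥ λ}-gmod ⊆ A-gmod`. -/
noncomputable def standardize (l : Λ) (W : GMod.{uk, uI, uA, uV} (B.algAt l)) :
    GMod.{uk, uI, uA, max uA uV} A :=
  inflate (B.idealGe l) (jShriek (A := B.algGe l) (B.indices {l}) W)

/-- Costandardization `A_λ-gmod → A_{≥ λ}-gmod ⊆ A-gmod`. -/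
noncomputable def costandardize (l : Λ) (W : GMod.{uk, uI, uA, uV} (B.algAt l)) :
    GMod.{uk, uI, uA, max uA uV} A :=
  inflate (B.idealGe l) (jStar (A := B.algGe l) (B.indices {l}) W)

/-- `V` is a `\bar Δ`-layer of type `λ`. -/
def IsBarDeltaLayer (l : Λ) (V : GMod.{uk, uI, uA, uV} A) : Prop :=
  ∃ W : GMod.{uk, uI, uA, uV} (B.algAt l), W.LocFinDim ∧ W.BddBelow ∧
    Nonempty (GMod.Iso V (B.standardize l W))

/-- `V` is a `\bar ∇`-layer of type `λ`. -/
def IsBarNablaLayer (l : Λ) (V : GMod.{uk, uI, uA, uV} A) : Prop :=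
  ∃ W : GMod.{uk, uI, uA, uV} (B.algAt l), W.LocFinDim ∧ W.BddAbove ∧
    Nonempty (GMod.Iso V (B.costandardize l W))

/-- `V` has a `\bar Δ`-flag: a finite filtration `0 = V_0 ⊆ ⋯ ⊆ V_n = V` by graded submodules
such that `V_{r+1} / V_r` is a `\bar Δ`-layer of type `λ_r`, with distinct `λ_r`. -/
def HasBarDeltaFlag (V : GMod.{uk, uI, uA, uV} A) : Prop :=
  ∃ (n : ℕ) (F : Fin (n + 1) → GSub V) (wts : Fin n → Λ)
    (hF : ∀ r : Fin n, (F r.castSucc).toSubmodule ≤ (F r.succ).toSubmodule),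
    (F 0).toSubmodule = ⊥ ∧ (F (Fin.last n)).toSubmodule = ⊤ ∧ Function.Injective wts ∧
    ∀ r : Fin n, B.IsBarDeltaLayer (wts r) ((F r.castSucc).subquot (F r.succ) (hF r))

/-- `V` has a `\bar ∇`-flag: a finite filtration `V = V_0 ⊇ ⋯ ⊇ V_n = 0` by graded submodules
such that `V_r / V_{r+1}` is a `\bar ∇`-layer of type `λ_r`, with distinct `λ_r`. -/
def HasBarNablaFlag (V : GMod.{uk, uI, uA, uV} A) : Prop :=
  ∃ (n : ℕ) (F : Fin (n + 1) → GSub V) (wts : Fin n → Λ)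
    (hF : ∀ r : Fin n, (F r.succ).toSubmodule ≤ (F r.castSucc).toSubmodule),
    (F 0).toSubmodule = ⊤ ∧ (F (Fin.last n)).toSubmodule = ⊥ ∧ Function.Injective wts ∧
    ∀ r : Fin n, B.IsBarNablaLayer (wts r) ((F r.succ).subquot (F r.castSucc) (hF r))

end TriBasis

end GradedTriangular

-- Write e for e_Γ. The image of the counit is AeV by construction and the kernel of the unit is V^Γ
-- by construction. What needs proof is that the counit is injective and that the unit is surjective
-- modulo V^Γ. Both follow by dévissage along the flag from the case of one layer.
--
-- Extensions. Truncation V ↦ eV is exact, j_! is right exact and j_* is left exact. By one half of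
-- the four lemma, injectivity of the counit passes from the ends of a short exact sequence to its
-- middle (`CounitInjective.of_exact`); by a similar chase so does surjectivity of the unit
-- (`UnitSurjective.of_exact`).
--
-- Layers of type λ ∉ Γ. Since Γ is a lower set, no μ ∈ Γ satisfies λ ≤ μ. Hence e lies in the ideal
-- J_λ generated by the e_μ with μ ≱ λ, and e kills the layer.
--
-- Layers of type λ ∈ Γ. Here the triangular basis enters. A generator a e_μ b of J_λ may have μ ∉
-- Γ, and such an e_μ cannot be moved across a tensor product over A_Γ. However, if e_μ b e_λ is
-- expanded in products xhy, each surviving product passes through an idempotent 1_s with ṡ ≤ μ and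
-- ṡ ≤ λ, and so ṡ < λ because λ ≰ μ. Thus J_λ e_λ, and likewise e_λ J_λ, lies in the sum of the A
-- e_ν A with ν < λ (`mul_idem_mem_spanLt`). These ν do belong to Γ, and e_ν acts as zero on every
-- layer of type λ.
--
-- It follows that ā ⊗ w ↦ a e_λ ⊗ (ē_λ ⊗ w) is a well-defined map from j_!^λ W to Ae ⊗_{A_Γ}
-- e(j_!^λ W). It is a left inverse of the counit (`counitInjective_standardize`). Dually, an
-- A_Γ-linear f : eA → j_*^λ W with f(x) = f(x 1_i) determines g(ā) = f(e_λ a)(ē_λ). This g is a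
-- well-defined element of j_*^λ W, and f(x) = x g for all x (`unitSurjective_costandardize`).
--
-- Finally, e(AeV) = eV and eV ∩ V^Γ = 0. These let the conclusions for AeV and V/V^Γ be read as
-- conclusions about eV.

universe uX

namespace GradedTriangular

/-! ### Products with sums of distinguished idempotents. -/

namespace GAlg

variable {k : Type uk} [Field k] {I : Type uI} (A : GAlg.{uk, uI, uA} k I)

theorem idem_mul_idem_of_superset {T U : Finset I} (h : T ⊆ U) :
    A.idem T * A.idem U = A.idem T := by
  conv_lhs => rw [show A.idem T = ∑ i ∈ T, A.one i from rfl]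
  rw [Finset.sum_mul]
  exact Finset.sum_congr rfl fun i hi => A.one_mul_idem (h hi)

theorem idem_mul_of_notMem {T : Finset I} {i : I} (hi : i ∉ T) {a : A}
    (ha : A.one i * a = a) : A.idem T * a = 0 := by
  rw [← ha, ← mul_assoc, idem, Finset.sum_mul, Finset.sum_eq_zero, zero_mul]
  exact fun j hj => A.one_mul_one_of_ne j i fun h => hi (h ▸ hj)

theorem mul_idem_of_notMem {T : Finset I} {i : I} (hi : i ∉ T) {a : A}
    (ha : a * A.one i = a) : a * A.idem T = 0 := by
  rw [← ha, mul_assoc, idem, Finset.mul_sum, Finset.sum_eq_zero, mul_zero]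
  exact fun j hj => A.one_mul_one_of_ne i j fun h => hi (h ▸ hj)

theorem mul_idem_of_mem {T : Finset I} {i : I} (hi : i ∈ T) {a : A}
    (ha : a * A.one i = a) : a * A.idem T = a := by
  rw [← ha, mul_assoc, A.one_mul_idem hi]

end GAlg

/-! ### The ideal J_λ next to e_λ: consequences of the triangular basis. -/

namespace TriBasis

variable {k : Type uk} [Field k] {I : Type uI} {A : GAlg.{uk, uI, uA} k I}
  {Λ : Type uL} [PartialOrder Λ] (B : TriBasis A Λ)

theorem indices_mono {Γ Γ' : Finset Λ} (h : Γ ⊆ Γ') : B.indices Γ ⊆ B.indices Γ' := by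
  intro i hi
  rw [mem_indices] at hi ⊢
  exact ⟨hi.1, h hi.2⟩

theorem mem_indices_wt (s : B.S) : (s : I) ∈ B.indices {B.wt s} :=
  (B.mem_indices _ _).2 ⟨s.2, Finset.mem_singleton_self _⟩

/-- Each summand is 1_i = 1_i e_m 1_i, where m is the weight of i. It is used with a lower set Γ not
containing l, and with Γ = {m} for m < l. -/
theorem idem_mem_idealGe {l : Λ} {Γ : Finset Λ} (h : ∀ m ∈ Γ, ¬ l ≤ m) :
    A.idem (B.indices Γ) ∈ (B.idealGe l).toSubmodule := by
  refine Submodule.sum_mem _ fun i hi => ?_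
  obtain ⟨hS, hm⟩ := (B.mem_indices _ _).1 hi
  refine Submodule.subset_span ⟨A.one i, _, ⟨_, h _ hm, rfl⟩, A.one i, ?_⟩
  rw [A.one_mul_idem (B.mem_indices_wt ⟨i, hS⟩), A.one_mul_one]

/-- The span of the products `b e_ν c` with `ν < l`. -/
def spanLt (l : Λ) : Submodule k A :=
  Submodule.span k {z | ∃ b, ∃ m < l, ∃ c, z = b * A.idem (B.indices {m}) * c}

theorem mem_spanLt {l : Λ} (s : B.S) (hs : B.wt s < l) {a b : A}
    (ha : a * A.one s = a) : a * b ∈ B.spanLt l :=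
  Submodule.subset_span ⟨a, _, hs, b, by rw [A.mul_idem_of_mem (B.mem_indices_wt s) ha]⟩

theorem basis_induction {P : A → Prop} (h0 : P 0) (hadd : ∀ a b, P a → P b → P (a + b))
    (hsmul : ∀ (c : k) a, P a → P (c • a))
    (h : ∀ s t i j, ∀ x ∈ B.X i s, ∀ y ∈ B.H s t, ∀ z ∈ B.Y t j, P (x * y * z)) (a : A) :
    P a := by
  have ha : a ∈ Submodule.span k (Set.range fun p : triples B.X B.H B.Y =>
      (p.1.1 * p.1.2.1 * p.1.2.2 : A)) := by
    rw [B.span_eq_top]; trivial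
  refine Submodule.span_induction (p := fun a _ => P a) ?_ h0 (fun a b _ _ => hadd a b)
    (fun c a _ => hsmul c a) ha
  rintro _ ⟨⟨⟨x, y, z⟩, s, t, ⟨i, hx⟩, hy, ⟨j, hz⟩⟩, rfl⟩
  exact h s t i j x hx y hy z hz

theorem wt_eq_of_mem_H {s t : B.S} {h : A} (hh : h ∈ B.H s t) : B.wt s = B.wt t := by
  by_cases hst : s = t
  · rw [hst]
  · exact B.H_eq s t hst ⟨h, hh⟩

theorem wt_le_of_mem_X {s t : B.S} {x : A} (hx : x ∈ B.X s t) : B.wt t ≤ B.wt s := by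
  by_cases hst : s = t
  · rw [hst]
  · exact (B.X_lt s t hst ⟨x, hx⟩).le

theorem wt_le_of_mem_Y {s t : B.S} {y : A} (hy : y ∈ B.Y s t) : B.wt s ≤ B.wt t := by
  by_cases hst : s = t
  · rw [hst]
  · exact (B.Y_lt s t hst ⟨y, hy⟩).le

/-- This is the only place where the order conditions on the triangular basis are needed. A basis
product xhy that survives between e_m and e_l factors through an idempotent whose weight is at most
both m and l. Equality with l would give l ≤ m. The mirrored statement serves the costandard
modules. -/
theorem idem_mul_mul_idem_mem_spanLt {l m : Λ} (hlm : ¬ l ≤ m) (a : A) :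
    A.idem (B.indices {m}) * a * A.idem (B.indices {l}) ∈ B.spanLt l ∧
      A.idem (B.indices {l}) * a * A.idem (B.indices {m}) ∈ B.spanLt l := by
  refine B.basis_induction (P := fun a =>
    A.idem (B.indices {m}) * a * A.idem (B.indices {l}) ∈ B.spanLt l ∧
      A.idem (B.indices {l}) * a * A.idem (B.indices {m}) ∈ B.spanLt l) (by simp) ?_ ?_ ?_ a
  · intro a b ha hb
    simp only [mul_add, add_mul]
    exact ⟨Submodule.add_mem _ ha.1 hb.1, Submodule.add_mem _ ha.2 hb.2⟩
  · intro c a ha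
    simp only [mul_smul_comm, smul_mul_assoc]
    exact ⟨Submodule.smul_mem _ c ha.1, Submodule.smul_mem _ c ha.2⟩
  intro s t i j x hx h hh y hy
  obtain ⟨hx1, hx2⟩ := B.X_mem i s x hx
  obtain ⟨hh1, hh2⟩ := B.H_mem s t h hh
  obtain ⟨hy1, hy2⟩ := B.Y_mem t j y hy
  have hst := B.wt_eq_of_mem_H hh
  -- Both claims reduce to ṡ < l: unless i has weight p and j has weight q the product vanishes, and
  -- otherwise it factors through 1_s.
  have key : ∀ p q : Λ, (∀ hi : i ∈ B.S, ∀ hj : j ∈ B.S, B.wt ⟨i, hi⟩ = p → B.wt ⟨j, hj⟩ = q →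
      B.wt s < l) → A.idem (B.indices {p}) * (x * h * y) * A.idem (B.indices {q}) ∈
        B.spanLt l := by
    intro p q hpq
    by_cases hi : i ∈ B.indices {p}
    swap
    · rw [A.idem_mul_of_notMem hi (by rw [← mul_assoc, ← mul_assoc, hx1]), zero_mul]
      exact Submodule.zero_mem _
    by_cases hj : j ∈ B.indices {q}
    swap
    · rw [mul_assoc, A.mul_idem_of_notMem hj (by rw [mul_assoc, hy2]), mul_zero]
      exact Submodule.zero_mem _
    obtain ⟨hi, hi'⟩ := (B.mem_indices _ _).1 hi
    obtain ⟨hj, hj'⟩ := (B.mem_indices _ _).1 hj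
    have hlt := hpq hi hj (Finset.mem_singleton.1 hi') (Finset.mem_singleton.1 hj')
    have : A.idem (B.indices {p}) * (x * h * y) * A.idem (B.indices {q}) =
        A.idem (B.indices {p}) * x * (h * y * A.idem (B.indices {q})) := by
      simp only [mul_assoc]
    rw [this]
    exact B.mem_spanLt s hlt (by rw [mul_assoc, hx2])
  refine ⟨key m l fun hi hj hp hq => ?_, key l m fun hi hj hp hq => ?_⟩
  -- X can only lower the weight from i to s, Y can only lower it from j to t, and H preserves it,
  -- so ṡ = ṫ lies below both outer weights.
  · have h1 : B.wt s ≤ m := hp ▸ B.wt_le_of_mem_X (s := ⟨i, hi⟩) hx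
    have h2 : B.wt t ≤ l := hq ▸ B.wt_le_of_mem_Y (t := ⟨j, hj⟩) hy
    exact lt_of_le_of_ne (hst ▸ h2) fun h => hlm (h ▸ h1)
  · have h1 : B.wt s ≤ l := hp ▸ B.wt_le_of_mem_X (s := ⟨i, hi⟩) hx
    have h2 : B.wt t ≤ m := hq ▸ B.wt_le_of_mem_Y (t := ⟨j, hj⟩) hy
    exact lt_of_le_of_ne h1 fun h => hlm (h ▸ hst ▸ h2)

theorem mul_mem_spanLt_left {l : Λ} (a : A) {z : A} (hz : z ∈ B.spanLt l) :
    a * z ∈ B.spanLt l := by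
  refine Submodule.span_induction (p := fun z _ => a * z ∈ B.spanLt l) ?_ ?_ ?_ ?_ hz
  · rintro _ ⟨b, m, hm, c, rfl⟩
    exact Submodule.subset_span ⟨a * b, m, hm, c, by simp only [mul_assoc]⟩
  · simp
  · intro x y _ _ hx hy
    rw [mul_add]; exact Submodule.add_mem _ hx hy
  · intro r x _ hx
    rw [mul_smul_comm]; exact Submodule.smul_mem _ r hx

theorem mul_mem_spanLt_right {l : Λ} (a : A) {z : A} (hz : z ∈ B.spanLt l) :
    z * a ∈ B.spanLt l := by
  refine Submodule.span_induction (p := fun z _ => z * a ∈ B.spanLt l) ?_ ?_ ?_ ?_ hz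
  · rintro _ ⟨b, m, hm, c, rfl⟩
    exact Submodule.subset_span ⟨b, m, hm, c * a, by simp only [mul_assoc]⟩
  · simp
  · intro x y _ _ hx hy
    rw [add_mul]; exact Submodule.add_mem _ hx hy
  · intro r x _ hx
    rw [smul_mul_assoc]; exact Submodule.smul_mem _ r hx

/-- On a generator a e_m b of the ideal, only the part e_m b e_l (resp. e_l a e_m) has to be
rewritten. The gain is that the weights m ≱ l, which may lie outside a lower set containing l, are
replaced by weights below l, which lie inside it. -/
theorem mul_idem_mem_spanLt {l : Λ} {a : A} (ha : a ∈ (B.idealGe l).toSubmodule) :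
    a * A.idem (B.indices {l}) ∈ B.spanLt l ∧ A.idem (B.indices {l}) * a ∈ B.spanLt l := by
  refine Submodule.span_induction (p := fun a _ => a * A.idem (B.indices {l}) ∈ B.spanLt l ∧
    A.idem (B.indices {l}) * a ∈ B.spanLt l) ?_ ?_ ?_ ?_ ha
  · rintro _ ⟨a, _, ⟨m, hm, rfl⟩, b, rfl⟩
    have h1 := B.mul_mem_spanLt_left a (B.idem_mul_mul_idem_mem_spanLt hm b).1
    have h2 := B.mul_mem_spanLt_right b (B.idem_mul_mul_idem_mem_spanLt hm a).2
    simp only [mul_assoc] at h1 h2 ⊢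
    exact ⟨h1, h2⟩
  · simp
  · intro x y _ _ hx hy
    rw [mul_add, add_mul]
    exact ⟨Submodule.add_mem _ hx.1 hy.1, Submodule.add_mem _ hx.2 hy.2⟩
  · intro r x _ hx
    rw [mul_smul_comm, smul_mul_assoc]
    exact ⟨Submodule.smul_mem _ r hx.1, Submodule.smul_mem _ r hx.2⟩

end TriBasis
-- Injectivity of the counit, and its behaviour in extensions.
section Functors

variable {k : Type uk} [Field k] {I : Type uI} {A : GAlg.{uk, uI, uA} k I} (T : Finset I)

theorem inflate_act_eq_zero (J : A.GIdeal) (W : GMod.{uk, uI, uA, uV} (A.quot J)) {a : A}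
    (ha : a ∈ J.toSubmodule) (v : inflate J W) : (inflate J W).act a v = 0 := by
  have h : A.quotMap J a = 0 := (Submodule.Quotient.mk_eq_zero _).2 ha
  exact LinearMap.congr_fun ((congrArg W.act h).trans (map_zero W.act)) v

/-- The map `e V → e W` induced by a homomorphism `V → W`. -/
def truncMap {V : GMod.{uk, uI, uA, uV} A} {W : GMod.{uk, uI, uA, uW} A} (f : GMod.Hom V W) :
    trunc T V →ₗ[k] trunc T W :=
  f.toLin.restrict fun v hv => by
    change W.act (A.idem T) (f.toLin v) = f.toLin v
    rw [← f.map_act]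
    exact congrArg f.toLin hv

theorem truncIncl_truncMap {V : GMod.{uk, uI, uA, uV} A} {W : GMod.{uk, uI, uA, uW} A}
    (f : GMod.Hom V W) (v : trunc T V) :
    truncIncl T W (truncMap T f v) = f.toLin (truncIncl T V v) := rfl

/-- The projection `V → e V`. -/
def truncProj (V : GMod.{uk, uI, uA, uV} A) : V →ₗ[k] trunc T V :=
  (V.act (A.idem T)).codRestrict _ fun v => by
    change V.act (A.idem T) (V.act (A.idem T) v) = V.act (A.idem T) v
    rw [← V.act_mul, A.idem_mul_idem]

theorem truncProj_truncIncl (V : GMod.{uk, uI, uA, uV} A) (v : trunc T V) :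
    truncProj T V (truncIncl T V v) = v := Subtype.ext v.2

/-- The counit `j_! j V → V` is injective. -/
def CounitInjective (V : GMod.{uk, uI, uA, uV} A) : Prop :=
  ∀ z, counitAux T V z = 0 → z ∈ balanced T (trunc T V)

variable {T}

theorem counitInjective_of_trunc_eq_zero {V : GMod.{uk, uI, uA, uV} A}
    (h : ∀ v, V.act (A.idem T) v = 0) : CounitInjective T V := by
  intro z _
  have : Subsingleton (trunc T V) :=
    ⟨fun u v => Subtype.ext (u.2.symm.trans ((h u.1).trans ((h v.1).symm.trans v.2)))⟩
  rw [Subsingleton.elim z 0]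
  exact Submodule.zero_mem _

/-- This makes Ae ⊗ eV → Ae ⊗ eW descend to the tensor products over eAe. -/
theorem map_balanced {V : GMod.{uk, uI, uA, uV} A} {W : GMod.{uk, uI, uA, uW} A}
    (f : GMod.Hom V W) {z : A.leftIdeal T ⊗[k] trunc T V} (hz : z ∈ balanced T (trunc T V)) :
    LinearMap.lTensor _ (truncMap T f) z ∈ balanced T (trunc T W) := by
  refine Submodule.span_induction
    (p := fun z _ => LinearMap.lTensor _ (truncMap T f) z ∈ balanced T (trunc T W))
    ?_ ?_ ?_ ?_ hz
  · rintro _ ⟨x, b, w, rfl⟩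
    refine Submodule.subset_span ⟨x, b, truncMap T f w, ?_⟩
    rw [map_sub, LinearMap.lTensor_tmul, LinearMap.lTensor_tmul]
    congr 2
    exact Subtype.ext (f.map_act _ _)
  · rw [map_zero]; exact Submodule.zero_mem _
  · intro x y _ _ hx hy
    rw [map_add]; exact Submodule.add_mem _ hx hy
  · intro c x _ hx
    rw [map_smul]; exact Submodule.smul_mem _ c hx

/-- Truncation is exact because it is multiplication by an idempotent: e times a preimage of w is
again a preimage of w. -/
theorem truncMap_surjective {V : GMod.{uk, uI, uA, uV} A} {W : GMod.{uk, uI, uA, uW} A}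
    (f : GMod.Hom V W) (hf : Function.Surjective f.toLin) :
    Function.Surjective (truncMap T f) := by
  intro w
  obtain ⟨v, hv⟩ := hf (truncIncl T W w)
  refine ⟨truncProj T V v, Subtype.ext ?_⟩
  change f.toLin (V.act (A.idem T) v) = truncIncl T W w
  rw [f.map_act, hv]
  exact w.2

/-- Every defining relation lifts, since its vector w lifts. Combined with exactness of Ae ⊗_k -,
this supplies the right exactness of Ae ⊗_{eAe} - without passing to the quotients. -/
theorem exists_mem_balanced {V : GMod.{uk, uI, uA, uV} A} {W : GMod.{uk, uI, uA, uW} A}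
    (f : GMod.Hom V W) (hf : Function.Surjective f.toLin)
    {z : A.leftIdeal T ⊗[k] trunc T W} (hz : z ∈ balanced T (trunc T W)) :
    ∃ y ∈ balanced T (trunc T V), LinearMap.lTensor _ (truncMap T f) y = z := by
  refine Submodule.span_induction
    (p := fun z _ => ∃ y ∈ balanced T (trunc T V), LinearMap.lTensor _ (truncMap T f) y = z)
    ?_ ?_ ?_ ?_ hz
  · rintro _ ⟨x, b, w, rfl⟩
    obtain ⟨v, rfl⟩ := truncMap_surjective (T := T) f hf w
    refine ⟨_, Submodule.subset_span ⟨x, b, v, rfl⟩, ?_⟩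
    rw [map_sub, LinearMap.lTensor_tmul, LinearMap.lTensor_tmul]
    congr 2
    exact Subtype.ext (f.map_act _ _)
  · exact ⟨0, Submodule.zero_mem _, map_zero _⟩
  · rintro _ _ _ _ ⟨x, hx, rfl⟩ ⟨y, hy, rfl⟩
    exact ⟨x + y, Submodule.add_mem _ hx hy, map_add _ _ _⟩
  · rintro c _ _ ⟨x, hx, rfl⟩
    exact ⟨c • x, Submodule.smul_mem _ c hx, map_smul _ _ _⟩

theorem counitAux_lTensor {V : GMod.{uk, uI, uA, uV} A} {W : GMod.{uk, uI, uA, uW} A}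
    (f : GMod.Hom V W) (z : A.leftIdeal T ⊗[k] trunc T V) :
    counitAux T W (LinearMap.lTensor _ (truncMap T f) z) = f.toLin (counitAux T V z) := by
  induction z using TensorProduct.induction_on with
  | zero => simp
  | add x y hx hy => rw [map_add, map_add, map_add, map_add, hx, hy]
  | tmul x v =>
    rw [LinearMap.lTensor_tmul, counitAux_tmul, counitAux_tmul, f.map_act, truncIncl_truncMap]

/-- Injectivity of the counit is inherited by extensions. -/
theorem CounitInjective.of_exact {N : GMod.{uk, uI, uA, uV} A} {M : GMod.{uk, uI, uA, uV} A}
    {L : GMod.{uk, uI, uA, uW} A} (hN : CounitInjective T N) (hL : CounitInjective T L)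
    (f : GMod.Hom N M) (hf : Function.Injective f.toLin) (g : GMod.Hom M L)
    (hg : Function.Surjective g.toLin) (hfg : Function.Exact f.toLin g.toLin) :
    CounitInjective T M := by
  intro z hz
  have hgz := hL (LinearMap.lTensor _ (truncMap T g) z)
    (by rw [counitAux_lTensor, hz, map_zero])
  -- Correcting z by a relation y makes its image in Ae ⊗ eL vanish exactly, so that z - y comes
  -- from Ae ⊗ eN.
  obtain ⟨y, hy, hyz⟩ := exists_mem_balanced g hg hgz
  have hexact : Function.Exact (truncMap T f) (truncMap T g) := by
    intro v
    constructor
    · intro hv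
      obtain ⟨n, hn⟩ := (hfg (truncIncl T M v)).1 (congrArg (truncIncl T L) hv)
      refine ⟨truncProj T N n, Subtype.ext ?_⟩
      change f.toLin (N.act (A.idem T) n) = truncIncl T M v
      rw [f.map_act, hn]
      exact v.2
    · rintro ⟨n, rfl⟩
      exact Subtype.ext ((hfg _).2 ⟨truncIncl T N n, rfl⟩)
  obtain ⟨x, hx⟩ := (lTensor_exact (A.leftIdeal T) hexact
    (truncMap_surjective g hg) (z - y)).1 (by rw [map_sub, hyz, sub_self])
  have hy0 : counitAux T M y = 0 := counitAux_balanced T M hy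
  -- Naturality and injectivity of N → M carry the vanishing back to N, where the hypothesis makes x
  -- a relation.
  have hx0 : counitAux T N x = 0 := by
    apply hf
    rw [← counitAux_lTensor, hx, map_sub, hz, hy0, sub_self, map_zero]
  have := Submodule.add_mem _ (map_balanced f (hN x hx0)) hy
  rwa [hx, sub_add_cancel] at this

theorem jShriekMk_mul (W : GMod.{uk, uI, uA, uV} (A.corner T)) (x : A.leftIdeal T)
    (b : A.corner T) (w : W) :
    jShriekMk T W (A.leftIdealMulCorner T b x) w = jShriekMk T W x (W.act b w) :=
  (Submodule.Quotient.eq (balanced T W)).2 (Submodule.subset_span ⟨x, b, w, rfl⟩)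

end Functors

/-! ### The counit on standard modules. -/

namespace TriBasis

variable {k : Type uk} [Field k] {I : Type uI} {A : GAlg.{uk, uI, uA} k I}
  {Λ : Type uL} [PartialOrder Λ] (B : TriBasis A Λ) {Γ : Finset Λ} {l : Λ}

/-- The quotient map `A → A_{≥ λ}`. -/
def quotGe (l : Λ) : A →ₗ[k] B.algGe l := A.quotMap (B.idealGe l)

theorem quotGe_mul (l : Λ) (a b : A) : B.quotGe l (a * b) = B.quotGe l a * B.quotGe l b := rfl

theorem quotGe_surjective (l : Λ) : Function.Surjective (B.quotGe l) :=
  (B.idealGe l).toSubmodule.mkQ_surjective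

theorem quotGe_idem (l : Λ) (T : Finset I) : B.quotGe l (A.idem T) = (B.algGe l).idem T :=
  map_sum (B.quotGe l) _ _

/-- The element `ē_λ` of `A_{≥ λ} ē_λ`. -/
noncomputable def barIdemLeft (l : Λ) : (B.algGe l).leftIdeal (B.indices {l}) :=
  ⟨(B.algGe l).idem (B.indices {l}), (B.algGe l).idem_mul_idem _⟩

/-- The map `W → e_Γ j_! W`, `w ↦ ē_λ ⊗ w`, for `λ ∈ Γ`. -/
noncomputable def standardizeIncl (hl : l ∈ Γ) (W : GMod.{uk, uI, uA, uV} (B.algAt l)) :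
    W →ₗ[k] trunc (B.indices Γ) (B.standardize l W) :=
  LinearMap.codRestrict _
    ((balanced (A := B.algGe l) (B.indices {l}) W).mkQ ∘ₗ
      TensorProduct.mk k _ W (B.barIdemLeft l)) fun w => by
    refine congrArg (fun x => jShriekMk (A := B.algGe l) (B.indices {l}) W x w)
      (Subtype.ext ?_)
    change B.quotGe l (A.idem (B.indices Γ)) * (B.algGe l).idem (B.indices {l}) =
      (B.algGe l).idem (B.indices {l})
    rw [quotGe_idem]
    exact (B.algGe l).idem_mul_idem_of_subset
      (B.indices_mono (Finset.singleton_subset_iff.2 hl))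

/-- The map `A → A e_Γ`, `a ↦ a e_λ`, for `λ ∈ Γ`. -/
noncomputable def mulIdemLeft (hl : l ∈ Γ) : A →ₗ[k] A.leftIdeal (B.indices Γ) :=
  (LinearMap.mulRight k (A.idem (B.indices {l}))).codRestrict _ fun a => by
    change a * A.idem (B.indices {l}) * A.idem (B.indices Γ) = a * A.idem (B.indices {l})
    rw [mul_assoc, A.idem_mul_idem_of_superset
      (B.indices_mono (Finset.singleton_subset_iff.2 hl))]

/-- The map `a, w ↦ a e_λ ⊗ (ē_λ ⊗ w)`. -/
noncomputable def counitInvAux (hl : l ∈ Γ) (W : GMod.{uk, uI, uA, uV} (B.algAt l)) :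
    A →ₗ[k] W →ₗ[k] jShriek (B.indices Γ) (trunc (B.indices Γ) (B.standardize l W)) :=
  ((TensorProduct.mk k _ _).compr₂ (balanced (B.indices Γ) _).mkQ).compl₁₂
    (B.mulIdemLeft hl) (B.standardizeIncl hl W)

theorem counitInvAux_apply (hl : l ∈ Γ) (W : GMod.{uk, uI, uA, uV} (B.algAt l)) (a : A)
    (w : W) : B.counitInvAux hl W a w = jShriekMk (B.indices Γ) _ (B.mulIdemLeft hl a)
      (B.standardizeIncl hl W w) := rfl

/-- For a ∈ J_λ, the element a e_λ is a sum of terms b e_ν c with ν < λ, and ν ∈ Γ because Γ is a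
lower set. Each term moves e_ν c across the tensor product over A_Γ, where e_ν annihilates j_!^λ W.
-/
theorem counitInvAux_eq_zero (hΓ : IsLowerSet (Γ : Set Λ)) (hl : l ∈ Γ)
    (W : GMod.{uk, uI, uA, uV} (B.algAt l)) {a : A}
    (ha : a ∈ (B.idealGe l).toSubmodule) : B.counitInvAux hl W a = 0 := by
  refine LinearMap.ext fun w => ?_
  rw [counitInvAux_apply, LinearMap.zero_apply]
  have key : ∀ z ∈ B.spanLt l, ∀ hz : z * A.idem (B.indices Γ) = z,
      jShriekMk (B.indices Γ) (trunc (B.indices Γ) (B.standardize l W)) ⟨z, hz⟩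
        (B.standardizeIncl hl W w) = 0 := by
    have h1 : ∀ z ∈ B.spanLt l,
        jShriekMk (B.indices Γ) (trunc (B.indices Γ) (B.standardize l W))
        ⟨z * A.idem (B.indices Γ), by
          change z * A.idem _ * A.idem _ = z * A.idem _
          rw [mul_assoc, A.idem_mul_idem]⟩ (B.standardizeIncl hl W w) = 0 := by
      intro z hz
      -- Individual summands of z need not lie in A e_Γ. Multiplying by e_Γ on the right gives a
      -- linear map defined on all of A, so the claim can be checked on generators of `spanLt`.
      let F : A →ₗ[k] jShriek (B.indices Γ) (trunc (B.indices Γ) (B.standardize l W)) :=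
        ((TensorProduct.mk k _ _).compr₂ (balanced (B.indices Γ) _).mkQ).flip
          (B.standardizeIncl hl W w) ∘ₗ
        (LinearMap.mulRight k (A.idem (B.indices Γ))).codRestrict
          (A.leftIdeal (B.indices Γ)) fun a => by
            change a * A.idem _ * A.idem _ = a * A.idem _
            rw [mul_assoc, A.idem_mul_idem]
      have hF : B.spanLt l ≤ LinearMap.ker F := by
        refine Submodule.span_le.2 ?_
        rintro _ ⟨b, m, hm, c, rfl⟩
        have hmΓ : ({m} : Finset Λ) ⊆ Γ := Finset.singleton_subset_iff.2 (hΓ hm.le hl)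
        have e1 := A.idem_mul_idem_of_superset (B.indices_mono hmΓ)
        have e2 := A.idem_mul_idem_of_subset (B.indices_mono hmΓ)
        let x : A.leftIdeal (B.indices Γ) := ⟨b * A.idem (B.indices {m}), by
          change b * A.idem _ * A.idem _ = b * A.idem _
          rw [mul_assoc, e1]⟩
        -- The element e_m c e_Γ lies in A_Γ because m ∈ Γ. Since e_m is idempotent, b e_m c e_Γ =
        -- (b e_m)(e_m c e_Γ).
        let c' : A.corner (B.indices Γ) :=
          ⟨A.idem (B.indices {m}) * c * A.idem (B.indices Γ), by
            rw [← mul_assoc, ← mul_assoc, e2], by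
            rw [mul_assoc, A.idem_mul_idem]⟩
        have h2 : (B.standardize l W).act (A.idem (B.indices {m}) * c * A.idem (B.indices Γ))
            (truncIncl (B.indices Γ) _ (B.standardizeIncl hl W w)) = 0 := by
          rw [mul_assoc, GMod.act_mul]
          exact inflate_act_eq_zero _ _ (B.idem_mem_idealGe fun p hp => by
            rw [Finset.mem_singleton.1 hp]; exact hm.not_ge) _
        have h3 : (trunc (B.indices Γ) (B.standardize l W)).act c'
            (B.standardizeIncl hl W w) = 0 := Subtype.ext h2
        have h4 := jShriekMk_mul _ x c' (B.standardizeIncl hl W w)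
        rw [h3] at h4
        refine Eq.trans ?_ (h4.trans ?_)
        · refine congrArg (fun x => jShriekMk (B.indices Γ) _ x (B.standardizeIncl hl W w))
            (Subtype.ext ?_)
          change b * A.idem (B.indices {m}) * c * A.idem (B.indices Γ) =
            b * A.idem (B.indices {m}) * (A.idem (B.indices {m}) * c * A.idem (B.indices Γ))
          rw [← mul_assoc, ← mul_assoc, mul_assoc b (A.idem _) (A.idem _), A.idem_mul_idem]
        · change (balanced _ _).mkQ (x ⊗ₜ[k] 0) = 0
          rw [TensorProduct.tmul_zero, map_zero]
      exact hF hz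
    intro z hz hz'
    rw [← h1 z hz]
    exact congrArg (fun x => jShriekMk (B.indices Γ) _ x (B.standardizeIncl hl W w))
      (Subtype.ext hz'.symm)
  exact key _ (B.mul_idem_mem_spanLt ha).1 _

/-- Here c ∈ A_Γ is a lift of b ∈ A_λ. The lemma converts scalars of A_λ into scalars of A_Γ, which
can then cross the outer tensor product. -/
theorem standardizeIncl_act (hl : l ∈ Γ) (W : GMod.{uk, uI, uA, uV} (B.algAt l))
    (b : B.algAt l) (c : A.corner (B.indices Γ))
    (h : B.quotGe l (A.cornerIncl _ c) = (B.algGe l).cornerIncl _ b) (w : W) :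
    B.standardizeIncl hl W (W.act b w) =
      (trunc (B.indices Γ) (B.standardize l W)).act c (B.standardizeIncl hl W w) := by
  refine Subtype.ext ((jShriekMk_mul (A := B.algGe l) W
    (B.barIdemLeft l) b w).symm.trans ?_)
  refine congrArg (fun x => jShriekMk (A := B.algGe l) (B.indices {l}) W x w) (Subtype.ext ?_)
  change (B.algGe l).idem (B.indices {l}) * (B.algGe l).cornerIncl _ b =
    B.quotGe l (A.cornerIncl _ c) * (B.algGe l).idem (B.indices {l})
  rw [h, (GAlg.cornerIncl_prop b).1, (GAlg.cornerIncl_prop b).2]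

/-- A linear map splitting the counit of `j_!^λ W`, for `λ ∈ Γ`. -/
theorem exists_counitInv (hΓ : IsLowerSet (Γ : Set Λ)) (hl : l ∈ Γ)
    (W : GMod.{uk, uI, uA, uV} (B.algAt l)) :
    ∃ σ : B.standardize l W →ₗ[k]
        jShriek (B.indices Γ) (trunc (B.indices Γ) (B.standardize l W)),
      ∀ (a : A) (x : (B.algGe l).leftIdeal (B.indices {l})) (w : W),
        B.quotGe l a = (x : B.algGe l) →
          σ (jShriekMk (A := B.algGe l) (B.indices {l}) W x w) = B.counitInvAux hl W a w := by
  let τ : B.algGe l →ₗ[k] W →ₗ[k]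
      jShriek (B.indices Γ) (trunc (B.indices Γ) (B.standardize l W)) :=
    (B.idealGe l).toSubmodule.liftQ (B.counitInvAux hl W) fun a ha =>
      B.counitInvAux_eq_zero hΓ hl W ha
  have hτ : ∀ a, τ (B.quotGe l a) = B.counitInvAux hl W a := fun a => rfl
  refine ⟨(balanced (A := B.algGe l) (B.indices {l}) W).liftQ (TensorProduct.lift
    (τ ∘ₗ ((B.algGe l).leftIdeal (B.indices {l})).subtype)) ?_, ?_⟩
  · refine Submodule.span_le.2 ?_
    rintro _ ⟨x, b, w, rfl⟩
    change TensorProduct.lift _ _ = 0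
    rw [map_sub, sub_eq_zero, TensorProduct.lift.tmul, TensorProduct.lift.tmul]
    change τ ((x : B.algGe l) * (B.algGe l).cornerIncl _ b) w = τ (x : B.algGe l) (W.act b w)
    obtain ⟨a, ha⟩ := B.quotGe_surjective l (x : B.algGe l)
    obtain ⟨c, hc⟩ := B.quotGe_surjective l ((B.algGe l).cornerIncl (B.indices {l}) b)
    have hlΓ : B.indices {l} ⊆ B.indices Γ :=
      B.indices_mono (Finset.singleton_subset_iff.2 hl)
    -- Truncating an arbitrary lift c of b by e_λ on both sides keeps its image equal to b and, as λ
    -- ∈ Γ, puts it in A_Γ.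
    let c' : A.corner (B.indices Γ) :=
      ⟨A.idem (B.indices {l}) * c * A.idem (B.indices {l}), by
        rw [← mul_assoc, ← mul_assoc, A.idem_mul_idem_of_subset hlΓ], by
        rw [mul_assoc, A.idem_mul_idem_of_superset hlΓ]⟩
    have hc' : B.quotGe l (A.cornerIncl _ c') = (B.algGe l).cornerIncl _ b := by
      change B.quotGe l (A.idem (B.indices {l}) * c * A.idem (B.indices {l})) = _
      rw [quotGe_mul, quotGe_mul, hc, quotGe_idem, (GAlg.cornerIncl_prop b).1,
        (GAlg.cornerIncl_prop b).2]
    rw [← ha, ← hc', ← quotGe_mul, hτ, hτ, counitInvAux_apply, counitInvAux_apply,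
      B.standardizeIncl_act hl W b c' hc', ← jShriekMk_mul]
    refine congrArg (fun x => jShriekMk (B.indices Γ) _ x (B.standardizeIncl hl W w))
      (Subtype.ext ?_)
    change a * (A.idem (B.indices {l}) * c * A.idem (B.indices {l})) * A.idem (B.indices {l}) =
      a * A.idem (B.indices {l}) * (A.idem (B.indices {l}) * c * A.idem (B.indices {l}))
    rw [mul_assoc, mul_assoc _ _ (A.idem _), A.idem_mul_idem, mul_assoc a, ← mul_assoc (A.idem _),
      ← mul_assoc (A.idem _), A.idem_mul_idem]
  · intro a x w h
    change τ (x : B.algGe l) w = _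
    rw [← h, hτ]

theorem idem_act_standardize (hΓ : IsLowerSet (Γ : Set Λ)) (hl : l ∉ Γ)
    (W : GMod.{uk, uI, uA, uV} (B.algAt l)) (v : B.standardize l W) :
    (B.standardize l W).act (A.idem (B.indices Γ)) v = 0 :=
  inflate_act_eq_zero _ _ (B.idem_mem_idealGe fun _ hm h => hl (hΓ h hm)) v

/-- When λ ∉ Γ, e_Γ annihilates the module. When λ ∈ Γ, the map σ of `exists_counitInv` sends a v to
the class of a ⊗ e_Γ v for every a ∈ A e_Γ. Composed with the counit it is therefore the identity on
classes. -/
theorem counitInjective_standardize (hΓ : IsLowerSet (Γ : Set Λ))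
    (W : GMod.{uk, uI, uA, uV} (B.algAt l)) :
    CounitInjective (B.indices Γ) (B.standardize l W) := by
  by_cases hl : l ∈ Γ
  swap
  · exact counitInjective_of_trunc_eq_zero (B.idem_act_standardize hΓ hl W)
  obtain ⟨σ, hσ⟩ := B.exists_counitInv hΓ hl W
  have key : ∀ (a : A.leftIdeal (B.indices Γ)) (v : B.standardize l W),
      σ ((B.standardize l W).act (a : A) v) =
        jShriekMk (B.indices Γ) _ a (truncProj (B.indices Γ) _ v) := by
    intro a
    refine LinearMap.congr_fun (f := σ ∘ₗ (B.standardize l W).act (a : A))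
      (g := ((balanced (B.indices Γ) _).mkQ ∘ₗ TensorProduct.mk k _ _ a) ∘ₗ
        truncProj (B.indices Γ) (B.standardize l W)) ?_
    refine Submodule.linearMap_qext _ (TensorProduct.ext' fun x w => ?_)
    obtain ⟨b, hb⟩ := B.quotGe_surjective l (x : B.algGe l)
    have hlΓ : B.indices {l} ⊆ B.indices Γ :=
      B.indices_mono (Finset.singleton_subset_iff.2 hl)
    have hx : (x : B.algGe l) * (B.algGe l).idem (B.indices {l}) = x := x.2
    -- With b a lift of x, the truncation e_Γ b e_λ lies in A_Γ and carries ē_λ ⊗ w to e_Γ (x ⊗ w).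
    -- Moving it to the left factor gives a e_Γ b e_λ = a b e_λ.
    let c : A.corner (B.indices Γ) :=
      ⟨A.idem (B.indices Γ) * b * A.idem (B.indices {l}), by
        rw [← mul_assoc, ← mul_assoc, A.idem_mul_idem], by
        rw [mul_assoc, A.idem_mul_idem_of_superset hlΓ]⟩
    have h1 : σ ((B.standardize l W).act (a : A)
        (jShriekMk (A := B.algGe l) (B.indices {l}) W x w)) =
        B.counitInvAux hl W ((a : A) * b) w :=
      hσ _ ((B.algGe l).leftIdealMul _ (B.quotGe l (a : A)) x) w (by
        rw [quotGe_mul, hb]; rfl)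
    have h2 : truncProj (B.indices Γ) (B.standardize l W)
        (jShriekMk (A := B.algGe l) (B.indices {l}) W x w) =
        (trunc (B.indices Γ) (B.standardize l W)).act c (B.standardizeIncl hl W w) := by
      refine Subtype.ext (congrArg (fun x => jShriekMk (A := B.algGe l) (B.indices {l}) W x w)
        (Subtype.ext ?_))
      change B.quotGe l (A.idem (B.indices Γ)) * (x : B.algGe l) =
        B.quotGe l (A.idem (B.indices Γ) * b * A.idem (B.indices {l})) *
          (B.algGe l).idem (B.indices {l})
      rw [quotGe_mul, quotGe_mul, hb, quotGe_idem, quotGe_idem, mul_assoc, mul_assoc,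
        (B.algGe l).idem_mul_idem, hx]
    refine h1.trans (Eq.trans ?_
      (congrArg (jShriekMk (B.indices Γ) (trunc _ (B.standardize l W)) a) h2).symm)
    rw [← jShriekMk_mul, counitInvAux_apply]
    refine congrArg (fun x => jShriekMk (B.indices Γ) _ x (B.standardizeIncl hl W w))
      (Subtype.ext ?_)
    change (a : A) * b * A.idem (B.indices {l}) =
      (a : A) * (A.idem (B.indices Γ) * b * A.idem (B.indices {l}))
    rw [← mul_assoc, ← mul_assoc, show (a : A) * A.idem (B.indices Γ) = a from a.2]
  have key2 : ∀ z : A.leftIdeal (B.indices Γ) ⊗[k] trunc (B.indices Γ) (B.standardize l W),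
      σ (counitAux (B.indices Γ) _ z) = (balanced (B.indices Γ) _).mkQ z := by
    intro z
    induction z using TensorProduct.induction_on with
    | zero => rw [map_zero, map_zero, map_zero]; rfl
    | add x y hx hy => rw [map_add, map_add, map_add, hx, hy]; rfl
    | tmul a v =>
      rw [counitAux_tmul, key, truncProj_truncIncl]
      rfl
  intro z hz
  have h := key2 z
  rw [hz, map_zero] at h
  exact (Submodule.Quotient.mk_eq_zero _).1 h.symm

end TriBasis
-- Surjectivity of the unit, and its behaviour in extensions.
section Functors

variable {k : Type uk} [Field k] {I : Type uI} {A : GAlg.{uk, uI, uA} k I} (T : Finset I)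

/-- The homogeneous elements of degree `d` in `Hom_{e A e}(e A 1_i, e M)`, viewed as maps
`e A → M`. -/
def homToModule (M : GMod.{uk, uI, uA, uV} A) (i : I) (d : ℤ) :
    Set (A.rightIdeal T →ₗ[k] M) :=
  {f | (∀ b x, f (A.rightIdealCornerMul T b x) = M.act (A.cornerIncl T b) (f x)) ∧
    (∀ x, f (A.rightIdealMul T (A.one i) x) = f x) ∧
    ∀ n, ∀ x : A.rightIdeal T, (x : A) ∈ A.deg n → f x ∈ M.deg (n + d)}

/-- Every homogeneous element of `j_* j M` is the image of a homogeneous element of `M` of the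
same degree. -/
def UnitSurjective (M : GMod.{uk, uI, uA, uV} A) : Prop :=
  ∀ i d, ∀ f ∈ homToModule T M i d, ∃ m ∈ M.deg d, ∀ x : A.rightIdeal T, f x = M.act (x : A) m

variable {T}

/-- Linearity over eAe, applied to e itself, forces the values into eM. This is why `homToModule`
may take all of M as target. -/
theorem idem_act_of_mem_homToModule {M : GMod.{uk, uI, uA, uV} A} {i : I} {d : ℤ}
    {f : A.rightIdeal T →ₗ[k] M} (hf : f ∈ homToModule T M i d) (x : A.rightIdeal T) :
    M.act (A.idem T) (f x) = f x := by
  refine (hf.1 ⟨A.idem T, A.idem_mul_idem T, A.idem_mul_idem T⟩ x).symm.trans ?_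
  exact congrArg f (Subtype.ext x.2)

theorem unitSurjective_of_trunc_eq_zero {M : GMod.{uk, uI, uA, uV} A}
    (h : ∀ v, M.act (A.idem T) v = 0) : UnitSurjective T M := by
  intro i d f hf
  refine ⟨0, Submodule.zero_mem _, fun x => ?_⟩
  rw [map_zero, ← idem_act_of_mem_homToModule hf x, h]

theorem comp_mem_homToModule {M : GMod.{uk, uI, uA, uV} A} {L : GMod.{uk, uI, uA, uW} A}
    (g : GMod.Hom M L) {i : I} {d : ℤ} {f : A.rightIdeal T →ₗ[k] M}
    (hf : f ∈ homToModule T M i d) : g.toLin ∘ₗ f ∈ homToModule T L i d := by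
  refine ⟨fun b x => ?_, fun x => ?_, fun n x hx => g.map_deg _ _ (hf.2.2 n x hx)⟩
  · rw [LinearMap.comp_apply, hf.1, g.map_act]; rfl
  · rw [LinearMap.comp_apply, hf.2.1]; rfl

/-- Surjectivity of the unit is inherited by extensions. -/
theorem UnitSurjective.of_exact {N : GMod.{uk, uI, uA, uV} A} {M : GMod.{uk, uI, uA, uV} A}
    {L : GMod.{uk, uI, uA, uW} A} (hN : UnitSurjective T N) (hL : UnitSurjective T L)
    (f : GMod.Hom N M) (hf : Function.Injective f.toLin)
    (hfd : ∀ d v, f.toLin v ∈ M.deg d → v ∈ N.deg d) (g : GMod.Hom M L)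
    (hgd : ∀ d, ∀ v ∈ L.deg d, ∃ m ∈ M.deg d, g.toLin m = v)
    (hfg : Function.Exact f.toLin g.toLin) : UnitSurjective T M := by
  intro i d p hp
  obtain ⟨v, hv, hpv⟩ := hL i d _ (comp_mem_homToModule g hp)
  obtain ⟨m, hm, rfl⟩ := hgd d v hv
  -- The lift m is replaced by 1_i m, still homogeneous of degree d, so that q has the same support
  -- condition q(x) = q(x 1_i) as p. Then p - q lands in the image of N and is again an admissible
  -- homomorphism.
  let q : A.rightIdeal T →ₗ[k] M :=
    (M.act ∘ₗ (A.rightIdeal T).subtype).flip (M.act (A.one i) m)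
  have hq : ∀ x, q x = M.act (x : A) (M.act (A.one i) m) := fun x => rfl
  have hm' : M.act (A.one i) m ∈ M.deg d := by
    simpa using M.act_mem_deg (A.one_mem_deg i) hm
  have hr : ∀ x, (p - q) x ∈ LinearMap.range f.toLin := by
    intro x
    refine (hfg _).1 ?_
    have h1 := hpv (A.rightIdealMul T (A.one i) x)
    rw [LinearMap.comp_apply, hp.2.1] at h1
    rw [LinearMap.sub_apply, map_sub, h1, hq, g.map_act, g.map_act, sub_eq_zero, ← L.act_mul]
    rfl
  let r : A.rightIdeal T →ₗ[k] N :=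
    (LinearEquiv.ofInjective f.toLin hf).symm.toLinearMap ∘ₗ (p - q).codRestrict _ hr
  have hfr : ∀ x, f.toLin (r x) = p x - q x := fun x =>
    congrArg Subtype.val ((LinearEquiv.ofInjective f.toLin hf).apply_symm_apply
      ((p - q).codRestrict _ hr x))
  have hrmem : r ∈ homToModule T N i d := by
    refine ⟨fun b x => hf ?_, fun x => hf ?_, fun n x hx => hfd _ _ ?_⟩
    · rw [f.map_act, hfr, hfr, map_sub, hp.1, hq, hq, ← M.act_mul (A.cornerIncl T b)]
      rfl
    · rw [hfr, hfr, hp.2.1, hq, hq, ← M.act_mul, ← M.act_mul]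
      congr 3
      change (x : A) * A.one i * A.one i = (x : A) * A.one i
      rw [mul_assoc, A.one_mul_one]
    · rw [hfr]
      exact Submodule.sub_mem _ (hp.2.2 n x hx) (M.act_mem_deg hx hm')
  obtain ⟨w, hw, hrw⟩ := hN i d r hrmem
  refine ⟨f.toLin w + M.act (A.one i) m, Submodule.add_mem _ (f.map_deg d w hw) hm',
    fun x => ?_⟩
  rw [map_add, ← f.map_act, ← hrw, hfr, hq, sub_add_cancel]

end Functors

/-! ### The unit on costandard modules. -/

namespace TriBasis

variable {k : Type uk} [Field k] {I : Type uI} {A : GAlg.{uk, uI, uA} k I}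
  {Λ : Type uL} [PartialOrder Λ] (B : TriBasis A Λ) {Γ : Finset Λ} {l : Λ}

/-- The element `ē_λ` of `ē_λ A_{≥ λ}`. -/
noncomputable def barIdemRight (l : Λ) : (B.algGe l).rightIdeal (B.indices {l}) :=
  ⟨(B.algGe l).idem (B.indices {l}), (B.algGe l).idem_mul_idem _⟩

/-- The map `j_*^λ W → W`, `f ↦ f ē_λ`. -/
noncomputable def costandardizeEval (W : GMod.{uk, uI, uA, uV} (B.algAt l)) :
    B.costandardize l W →ₗ[k] W :=
  LinearMap.applyₗ (B.barIdemRight l) ∘ₗ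
    (jStarSub (A := B.algGe l) (B.indices {l}) W).subtype

/-- Evaluation of an element of `j_*^λ W` at an element of `ē_λ A_{≥ λ}`. -/
noncomputable def costandardizeApply {W : GMod.{uk, uI, uA, uV} (B.algAt l)} (f : B.costandardize l W)
    (y : (B.algGe l).rightIdeal (B.indices {l})) : W :=
  jStarEval (A := B.algGe l) (B.indices {l}) W f y

theorem costandardizeApply_act {W : GMod.{uk, uI, uA, uV} (B.algAt l)}
    (f : B.costandardize l W) (a : A) (y : (B.algGe l).rightIdeal (B.indices {l})) :
    B.costandardizeApply ((B.costandardize l W).act a f) y =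
      B.costandardizeApply f ((B.algGe l).rightIdealMul _ (B.quotGe l a) y) := rfl

theorem costandardize_ext {W : GMod.{uk, uI, uA, uV} (B.algAt l)} {f g : B.costandardize l W}
    (h : ∀ y, B.costandardizeApply f y = B.costandardizeApply g y) : f = g :=
  Subtype.ext (LinearMap.ext h)

theorem idem_act_costandardize (hΓ : IsLowerSet (Γ : Set Λ)) (hl : l ∉ Γ)
    (W : GMod.{uk, uI, uA, uV} (B.algAt l)) (v : B.costandardize l W) :
    (B.costandardize l W).act (A.idem (B.indices Γ)) v = 0 :=
  inflate_act_eq_zero _ _ (B.idem_mem_idealGe fun _ hm h => hl (hΓ h hm)) v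

/-- The map `A → e_Γ A`, `a ↦ e_λ a`, for `λ ∈ Γ`. -/
noncomputable def mulIdemRight (hl : l ∈ Γ) : A →ₗ[k] A.rightIdeal (B.indices Γ) :=
  (LinearMap.mulLeft k (A.idem (B.indices {l}))).codRestrict _ fun a => by
    change A.idem (B.indices Γ) * (A.idem (B.indices {l}) * a) = A.idem (B.indices {l}) * a
    rw [← mul_assoc, A.idem_mul_idem_of_subset
      (B.indices_mono (Finset.singleton_subset_iff.2 hl))]

/-- Dual to `counitInvAux_eq_zero`: e_λ a is a sum of terms b e_m c with m < λ, so m ∈ Γ. By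
A_Γ-linearity f(e_Γ b e_m c) = e_Γ b e_m f(e_m c), and e_m annihilates j_*^λ W. -/
theorem apply_mulIdemRight_eq_zero (hΓ : IsLowerSet (Γ : Set Λ)) (hl : l ∈ Γ)
    {W : GMod.{uk, uI, uA, uV} (B.algAt l)} {i : I} {d : ℤ}
    {f : A.rightIdeal (B.indices Γ) →ₗ[k] B.costandardize l W}
    (hf : f ∈ homToModule (B.indices Γ) (B.costandardize l W) i d) {a : A}
    (ha : a ∈ (B.idealGe l).toSubmodule) : f (B.mulIdemRight hl a) = 0 := by
  let p : A →ₗ[k] A.rightIdeal (B.indices Γ) :=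
    (LinearMap.mulLeft k (A.idem (B.indices Γ))).codRestrict _ fun a => by
      change A.idem _ * (A.idem _ * a) = A.idem _ * a
      rw [← mul_assoc, A.idem_mul_idem]
  have hp : B.spanLt l ≤ LinearMap.ker (f ∘ₗ p) := by
    refine Submodule.span_le.2 ?_
    rintro _ ⟨b, m, hm, c, rfl⟩
    have hmΓ : ({m} : Finset Λ) ⊆ Γ := Finset.singleton_subset_iff.2 (hΓ hm.le hl)
    have e1 := A.idem_mul_idem_of_superset (B.indices_mono hmΓ)
    have e2 := A.idem_mul_idem_of_subset (B.indices_mono hmΓ)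
    let x : A.rightIdeal (B.indices Γ) := ⟨A.idem (B.indices {m}) * c, by
      change A.idem _ * (A.idem _ * c) = A.idem _ * c
      rw [← mul_assoc, e2]⟩
    let b' : A.corner (B.indices Γ) :=
      ⟨A.idem (B.indices Γ) * b * A.idem (B.indices {m}), by
        rw [← mul_assoc, ← mul_assoc, A.idem_mul_idem], by rw [mul_assoc, e1]⟩
    have h1 : p (b * A.idem (B.indices {m}) * c) = A.rightIdealCornerMul _ b' x := by
      refine Subtype.ext ?_
      change A.idem _ * (b * A.idem (B.indices {m}) * c) =
        A.idem _ * b * A.idem (B.indices {m}) * (A.idem (B.indices {m}) * c)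
      rw [← mul_assoc (A.idem _ * b * A.idem _), mul_assoc (A.idem _ * b), A.idem_mul_idem]
      simp only [mul_assoc]
    change f (p _) = 0
    rw [h1, hf.1]
    change (B.costandardize l W).act (A.idem (B.indices Γ) * b * A.idem (B.indices {m})) _ = 0
    rw [GMod.act_mul]
    refine (congrArg _ (inflate_act_eq_zero _ _ (B.idem_mem_idealGe fun p hp => ?_) _)).trans
      (map_zero _)
    rw [Finset.mem_singleton.1 hp]
    exact hm.not_ge
  have h2 : p (A.idem (B.indices {l}) * a) = B.mulIdemRight hl a :=
    Subtype.ext (B.mulIdemRight hl a).2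
  rw [← h2]
  exact hp (B.mul_idem_mem_spanLt ha).2

/-- An element g of j_*^λ W is recovered from its action map f(x) = x g by g(ā) = f(e_λ a)(ē_λ). For
an arbitrary admissible f, this formula descends to A_{≥λ} by `apply_mulIdemRight_eq_zero`, and g
then represents f. -/
theorem unitSurjective_costandardize (hΓ : IsLowerSet (Γ : Set Λ))
    (W : GMod.{uk, uI, uA, uV} (B.algAt l)) :
    UnitSurjective (B.indices Γ) (B.costandardize l W) := by
  by_cases hl : l ∈ Γ
  swap
  · exact unitSurjective_of_trunc_eq_zero (B.idem_act_costandardize hΓ hl W)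
  have hlΓ : B.indices {l} ⊆ B.indices Γ :=
    B.indices_mono (Finset.singleton_subset_iff.2 hl)
  intro i d f hf
  let τ : B.algGe l →ₗ[k] W := (B.idealGe l).toSubmodule.liftQ
    (B.costandardizeEval W ∘ₗ f ∘ₗ B.mulIdemRight hl) fun a ha => by
      change B.costandardizeEval W (f (B.mulIdemRight hl a)) = 0
      rw [B.apply_mulIdemRight_eq_zero hΓ hl hf ha, map_zero]
  have hτ : ∀ a, τ (B.quotGe l a) = B.costandardizeApply (f (B.mulIdemRight hl a))
    (B.barIdemRight l) := fun a => rfl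
  let g : (B.algGe l).rightIdeal (B.indices {l}) →ₗ[k] W :=
    τ ∘ₗ ((B.algGe l).rightIdeal (B.indices {l})).subtype
  have hg : g ∈ gradedHom (A := B.algGe l) (B.indices {l}) W i d := by
    refine ⟨fun b y => ?_, fun y => ?_, fun n y hy => ?_⟩
    · obtain ⟨a, ha⟩ := B.quotGe_surjective l (y : B.algGe l)
      obtain ⟨c, hc⟩ := B.quotGe_surjective l ((B.algGe l).cornerIncl (B.indices {l}) b)
      -- A lift of b in A_Γ, chosen so that the A_Γ-linearity of f yields the A_λ-linearity of g.
      let c' : A.corner (B.indices Γ) :=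
        ⟨A.idem (B.indices {l}) * c * A.idem (B.indices {l}), by
          rw [← mul_assoc, ← mul_assoc, A.idem_mul_idem_of_subset hlΓ], by
          rw [mul_assoc, A.idem_mul_idem_of_superset hlΓ]⟩
      have hc' : B.quotGe l (A.cornerIncl _ c') = (B.algGe l).cornerIncl _ b := by
        change B.quotGe l (A.idem (B.indices {l}) * c * A.idem (B.indices {l})) = _
        rw [quotGe_mul, quotGe_mul, hc, quotGe_idem, (GAlg.cornerIncl_prop b).1,
          (GAlg.cornerIncl_prop b).2]
      change τ ((B.algGe l).cornerIncl _ b * (y : B.algGe l)) = W.act b (τ (y : B.algGe l))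
      have h1 : B.mulIdemRight hl (A.cornerIncl _ c' * a) =
          A.rightIdealCornerMul _ c' (B.mulIdemRight hl a) := by
        refine Subtype.ext ?_
        change A.idem (B.indices {l}) * (A.idem (B.indices {l}) * c * A.idem (B.indices {l}) * a) =
          A.idem (B.indices {l}) * c * A.idem (B.indices {l}) * (A.idem (B.indices {l}) * a)
        rw [← mul_assoc (A.idem (B.indices {l}) * c * _), mul_assoc _ (A.idem _) (A.idem _),
          A.idem_mul_idem, ← mul_assoc, ← mul_assoc, ← mul_assoc, A.idem_mul_idem]
      rw [← hc', ← ha, ← quotGe_mul, hτ, hτ, h1, hf.1, costandardizeApply_act, hc']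
      refine Eq.trans ?_ (jStar_linear (A := B.algGe l) (B.indices {l}) W
        (f (B.mulIdemRight hl a)) b (B.barIdemRight l))
      refine congrArg (B.costandardizeApply (f (B.mulIdemRight hl a))) (Subtype.ext ?_)
      exact (GAlg.cornerIncl_prop b).1.trans (GAlg.cornerIncl_prop b).2.symm
    · obtain ⟨a, ha⟩ := B.quotGe_surjective l (y : B.algGe l)
      change τ ((y : B.algGe l) * B.quotGe l (A.one i)) = τ (y : B.algGe l)
      rw [← ha, ← quotGe_mul, hτ, hτ, ← hf.2.1 (B.mulIdemRight hl a)]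
      refine congrArg (fun x => B.costandardizeApply (f x) (B.barIdemRight l)) (Subtype.ext ?_)
      exact (mul_assoc _ _ _).symm
    -- The grading of A_{≥λ} is the image of that of A, so y has a homogeneous lift a. Both e_λ and
    -- ē_λ have degree 0, so the formula for g shifts degrees by d only.
    · obtain ⟨a, ha, hay⟩ := hy
      change τ (y : B.algGe l) ∈ _
      rw [← hay]
      have h1 : (B.mulIdemRight hl a : A) ∈ A.deg n := by
        have := A.mul_mem_deg (A.idem_mem_deg (B.indices {l})) ha
        rwa [zero_add] at this
      have h2 := hf.2.2 n _ h1 0 (B.barIdemRight l) ((B.algGe l).idem_mem_deg _)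
      rw [zero_add] at h2
      exact h2
  refine ⟨⟨g, Submodule.subset_span ⟨i, d, hg⟩⟩, hg.2.2, fun x => B.costandardize_ext fun y => ?_⟩
  obtain ⟨b, hb⟩ := B.quotGe_surjective l (y : B.algGe l)
  change _ = τ ((y : B.algGe l) * B.quotGe l (x : A))
  -- As x = e_Γ x, one has e_λ b x = (e_λ b e_Γ) x with e_λ b e_Γ ∈ A_Γ. Linearity of f turns g(y x)
  -- into f(x) evaluated at ē_λ times the image of e_λ b e_Γ, which is y e_Γ. The last factor is
  -- absorbed because e_Γ fixes f(x).
  let c : A.corner (B.indices Γ) := ⟨A.idem (B.indices {l}) * b * A.idem (B.indices Γ), by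
    rw [← mul_assoc, ← mul_assoc, A.idem_mul_idem_of_subset hlΓ], by
    rw [mul_assoc, A.idem_mul_idem]⟩
  have h1 : B.mulIdemRight hl (b * x) = A.rightIdealCornerMul _ c x := by
    refine Subtype.ext ?_
    change A.idem _ * (b * (x : A)) = A.idem (B.indices {l}) * b * A.idem (B.indices Γ) * (x : A)
    rw [mul_assoc _ (A.idem _) (x : A), show A.idem (B.indices Γ) * (x : A) = x from x.2, mul_assoc]
  rw [← hb, ← quotGe_mul, hτ, h1, hf.1, costandardizeApply_act,
    ← idem_act_of_mem_homToModule hf x, costandardizeApply_act, idem_act_of_mem_homToModule hf x]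
  refine congrArg (B.costandardizeApply (f x)) (Subtype.ext ?_)
  change (y : B.algGe l) * B.quotGe l (A.idem (B.indices Γ)) =
    (B.algGe l).idem (B.indices {l}) *
      B.quotGe l (A.idem (B.indices {l}) * b * A.idem (B.indices Γ))
  rw [quotGe_mul, quotGe_mul, hb, ← mul_assoc, ← mul_assoc, quotGe_idem, quotGe_idem,
    (B.algGe l).idem_mul_idem, show (B.algGe l).idem (B.indices {l}) * (y : B.algGe l) = y from y.2]

end TriBasis
-- Homomorphisms, subquotients, and the passage from V_Γ and V/V^Γ to V.
section Homs

variable {k : Type uk} [Field k] {I : Type uI} {A : GAlg.{uk, uI, uA} k I}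

/-- The composition of two homomorphisms. -/
def GMod.Hom.comp {U : GMod.{uk, uI, uA, uV} A} {V : GMod.{uk, uI, uA, uW} A}
    {W : GMod.{uk, uI, uA, uX} A} (g : GMod.Hom V W) (f : GMod.Hom U V) : GMod.Hom U W where
  toLin := g.toLin ∘ₗ f.toLin
  map_act a v := (congrArg g.toLin (f.map_act a v)).trans (g.map_act a _)
  map_deg d v hv := g.map_deg d _ (f.map_deg d v hv)

/-- An isomorphism, viewed as a homomorphism. -/
def GMod.Iso.toHom {V : GMod.{uk, uI, uA, uV} A} {W : GMod.{uk, uI, uA, uW} A}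
    (f : GMod.Iso V W) : GMod.Hom V W where
  toLin := f.toEquiv.toLinearMap
  map_act := f.map_act
  map_deg d v hv := (f.map_deg d v).2 hv

/-- Split v as x + y with x of degree d and y in the other degrees. The image of y lies both in
degree d and in the sum of the other degrees, so it is zero and y = 0. -/
theorem mem_deg_of_injective {V : GMod.{uk, uI, uA, uV} A} {W : GMod.{uk, uI, uA, uW} A}
    (f : GMod.Hom V W) (hf : Function.Injective f.toLin) {d : ℤ} {v : V}
    (hv : f.toLin v ∈ W.deg d) : v ∈ V.deg d := by
  have h1 := mem_iSup_deg V.isInternal_deg v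
  rw [iSup_split_single V.deg d, Submodule.mem_sup] at h1
  obtain ⟨x, hx, y, hy, rfl⟩ := h1
  have h2 : f.toLin y ∈ ⨆ j, ⨆ (_ : j ≠ d), W.deg j := by
    have : (⨆ j, ⨆ (_ : j ≠ d), V.deg j) ≤ (⨆ j, ⨆ (_ : j ≠ d), W.deg j).comap f.toLin :=
      iSup₂_le fun j hj z hz =>
        Submodule.mem_iSup_of_mem j (Submodule.mem_iSup_of_mem hj (f.map_deg j z hz))
    exact this hy
  have h3 : f.toLin y ∈ W.deg d := by
    have := Submodule.sub_mem _ hv (f.map_deg d x hx)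
    rwa [map_add, add_sub_cancel_left] at this
  have h4 := Submodule.disjoint_def.1 (W.isInternal_deg.submodule_iSupIndep d) _ h3 h2
  rw [hf (h4.trans (map_zero _).symm), add_zero]
  exact hx

/-- A bijective homomorphism is an isomorphism. -/
noncomputable def GMod.Hom.toIso {V : GMod.{uk, uI, uA, uV} A} {W : GMod.{uk, uI, uA, uW} A}
    (f : GMod.Hom V W) (hf : Function.Bijective f.toLin) : GMod.Iso V W where
  toEquiv := LinearEquiv.ofBijective f.toLin hf
  map_act := f.map_act
  map_deg d v := ⟨fun h => mem_deg_of_injective f hf.1 h, f.map_deg d v⟩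

namespace GSub

variable {V : GMod.{uk, uI, uA, uV} A}

/-- The inclusion of a graded submodule, as a homomorphism. -/
def inclHom (N : GSub V) : GMod.Hom N.toGMod V where
  toLin := N.incl
  map_act _ _ := rfl
  map_deg _ _ hv := hv

/-- The projection to a quotient, as a homomorphism. -/
def projHom (N : GSub V) : GMod.Hom V N.quot where
  toLin := N.proj
  map_act _ _ := rfl
  map_deg _ v hv := ⟨v, hv, rfl⟩

/-- The inclusion of one graded submodule in another. -/
def inclusion (N P : GSub V) (h : N.toSubmodule ≤ P.toSubmodule) :
    GMod.Hom N.toGMod P.toGMod where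
  toLin := Submodule.inclusion h
  map_act _ _ := rfl
  map_deg _ _ hv := hv

/-- The projection from a graded submodule to a subquotient. -/
def subquotProj (N P : GSub V) (h : N.toSubmodule ≤ P.toSubmodule) :
    GMod.Hom P.toGMod (N.subquot P h) :=
  (N.inside P h).projHom

theorem subquotProj_surjective (N P : GSub V) (h : N.toSubmodule ≤ P.toSubmodule) :
    Function.Surjective (N.subquotProj P h).toLin :=
  (N.inside P h).toSubmodule.mkQ_surjective

theorem exact_subquotProj (N P : GSub V) (h : N.toSubmodule ≤ P.toSubmodule) :
    Function.Exact (N.inclusion P h).toLin (N.subquotProj P h).toLin := by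
  intro v
  refine (Submodule.Quotient.mk_eq_zero _).trans ⟨fun hv => ⟨⟨v.1, hv⟩, rfl⟩, ?_⟩
  rintro ⟨u, rfl⟩
  exact u.2

variable {T : Finset I}

theorem counitInjective_of_subquot {W : GMod.{uk, uI, uA, uW} A} (N P : GSub V)
    (h : N.toSubmodule ≤ P.toSubmodule) (φ : GMod.Iso (N.subquot P h) W)
    (hN : CounitInjective T N.toGMod) (hW : CounitInjective T W) :
    CounitInjective T P.toGMod :=
  hN.of_exact hW (N.inclusion P h) (Submodule.inclusion_injective h)
    (φ.toHom.comp (N.subquotProj P h))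
    (φ.toEquiv.surjective.comp (N.subquotProj_surjective P h))
    fun v => φ.toEquiv.map_eq_zero_iff.trans (N.exact_subquotProj P h v)

/-- The unit argument needs homogeneous lifts along P → W. They exist because the degree pieces of a
quotient are by definition images of degree pieces. -/
theorem unitSurjective_of_subquot {W : GMod.{uk, uI, uA, uW} A} (N P : GSub V)
    (h : N.toSubmodule ≤ P.toSubmodule) (φ : GMod.Iso (N.subquot P h) W)
    (hN : UnitSurjective T N.toGMod) (hW : UnitSurjective T W) :
    UnitSurjective T P.toGMod := by
  refine hN.of_exact hW (N.inclusion P h) (Submodule.inclusion_injective h) (fun _ _ hv => hv)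
    (φ.toHom.comp (N.subquotProj P h)) ?_
    fun v => φ.toEquiv.map_eq_zero_iff.trans (N.exact_subquotProj P h v)
  intro d w hw
  obtain ⟨u, rfl⟩ := φ.toEquiv.surjective w
  obtain ⟨v, hv, rfl⟩ := (φ.map_deg d u).1 hw
  exact ⟨v, hv, rfl⟩

theorem act_eq_zero_of_eq_bot {N : GSub V} (hN : N.toSubmodule = ⊥) (a : A) (v : N.toGMod) :
    N.toGMod.act a v = 0 := by
  have h : ∀ u : N.toGMod, u = 0 := fun u => Subtype.ext ((Submodule.eq_bot_iff _).1 hN _ u.2)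
  exact h _

end GSub

/-- The counit only sees eM, so f need only hit the vectors fixed by e. This allows AeV to be
compared with V, and the top step of a filtration with the whole module. -/
theorem counitInjective_of_surjective {T : Finset I} {N : GMod.{uk, uI, uA, uV} A}
    {M : GMod.{uk, uI, uA, uW} A} (f : GMod.Hom N M) (hinj : Function.Injective f.toLin)
    (hsurj : ∀ v, M.act (A.idem T) v = v → ∃ u, f.toLin u = v)
    (hN : CounitInjective T N) : CounitInjective T M := by
  have h : Function.Surjective (truncMap T f) := by
    intro w
    obtain ⟨u, hu⟩ := hsurj (truncIncl T M w) w.2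
    refine ⟨truncProj T N u, Subtype.ext ?_⟩
    change f.toLin (N.act (A.idem T) u) = truncIncl T M w
    rw [f.map_act, hu]
    exact w.2
  intro z hz
  obtain ⟨y, rfl⟩ := LinearMap.lTensor_surjective (A.leftIdeal T) h z
  rw [counitAux_lTensor] at hz
  exact map_balanced f (hN y (hinj (hz.trans (map_zero _).symm)))

theorem UnitSurjective.of_bijective {T : Finset I} {N : GMod.{uk, uI, uA, uV} A}
    {M : GMod.{uk, uI, uA, uV} A} (hN : UnitSurjective T N) (f : GMod.Hom N M)
    (hf : Function.Bijective f.toLin) : UnitSurjective T M := by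
  intro i d p hp
  let φ : GMod.Hom M N :=
    { toLin := (f.toIso hf).toEquiv.symm.toLinearMap
      map_act := fun a v => by
        apply hf.1
        refine ((f.toIso hf).toEquiv.apply_symm_apply _).trans (Eq.trans ?_ (f.map_act _ _).symm)
        exact congrArg (M.act a) ((f.toIso hf).toEquiv.apply_symm_apply v).symm
      map_deg := fun d v hv => ((f.toIso hf).map_deg d _).1
        (by rwa [LinearEquiv.coe_coe, LinearEquiv.apply_symm_apply]) }
  obtain ⟨n, hn, h⟩ := hN i d _ (comp_mem_homToModule φ hp)
  refine ⟨f.toLin n, f.map_deg d n hn, fun x => ?_⟩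
  rw [← f.map_act, ← h]
  exact ((f.toIso hf).toEquiv.apply_symm_apply (p x)).symm

theorem idem_act_mem_genSub (T : Finset I) (V : GMod.{uk, uI, uA, uV} A) (a : A) {v : V}
    (hv : V.act (A.idem T) v = v) : V.act a v ∈ (genSub T V).toSubmodule :=
  Submodule.subset_span ⟨a, v, by rw [hv]⟩

/-- If the counit `j_! j (A e V) → A e V` is injective, then the counit `j_! j V → V` is an
isomorphism onto `A e V`. -/
theorem exists_iso_genSub (T : Finset I) (V : GMod.{uk, uI, uA, uV} A)
    (h : CounitInjective T (genSub T V).toGMod) :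
    ∃ φ : GMod.Iso (jShriek T (trunc T V)) (genSub T V).toGMod,
      ∀ z, (genSub T V).incl (φ.toEquiv z) = (counit T V).toLin z := by
  -- Every v = e v lies in AeV, so AeV and V have the same truncation.
  have hinj : CounitInjective T V := counitInjective_of_surjective (genSub T V).inclHom
    Subtype.val_injective (fun v hv =>
      ⟨⟨v, by simpa only [hv] using idem_act_mem_genSub T V (A.idem T) hv⟩, rfl⟩) h
  have hmem : ∀ z, (counit T V).toLin z ∈ (genSub T V).toSubmodule := by
    intro z
    obtain ⟨z, rfl⟩ := (balanced T (trunc T V)).mkQ_surjective z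
    change counitAux T V z ∈ _
    induction z using TensorProduct.induction_on with
    | zero => rw [map_zero]; exact Submodule.zero_mem _
    | add x y hx hy => rw [map_add]; exact Submodule.add_mem _ hx hy
    | tmul x v => exact idem_act_mem_genSub T V x v.2
  let f : GMod.Hom (jShriek T (trunc T V)) (genSub T V).toGMod :=
    { toLin := (counit T V).toLin.codRestrict _ hmem
      map_act := fun a z => Subtype.ext ((counit T V).map_act a z)
      map_deg := (counit T V).map_deg }
  refine ⟨f.toIso ⟨?_, ?_⟩, fun z => rfl⟩
  · refine (injective_iff_map_eq_zero f.toLin).2 fun z hz => ?_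
    obtain ⟨z, rfl⟩ := (balanced T (trunc T V)).mkQ_surjective z
    exact (Submodule.Quotient.mk_eq_zero _).2 (hinj z (congrArg Subtype.val hz))
  · rintro ⟨v, hv⟩
    have : (genSub T V).toSubmodule ≤ LinearMap.range (counit T V).toLin := by
      refine Submodule.span_le.2 ?_
      rintro _ ⟨a, v, rfl⟩
      -- The generator a e v is the image of ae ⊗ ev.
      refine ⟨jShriekMk T _ ⟨a * A.idem T, ?_⟩ (truncProj T V v), ?_⟩
      · change a * A.idem T * A.idem T = a * A.idem T
        rw [mul_assoc, A.idem_mul_idem]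
      · rw [counit_apply]
        change V.act (a * A.idem T) (V.act (A.idem T) v) = _
        rw [← V.act_mul, mul_assoc, A.idem_mul_idem, V.act_mul]
    obtain ⟨z, hz⟩ := this hv
    exact ⟨z, Subtype.ext hz⟩

/-- If every homogeneous element of `j_* j (V / V')`, where `V' = {v | e A v = 0}`, comes from
`V / V'`, then the unit `V → j_* j V` induces an isomorphism on `V / V'`. -/
theorem exists_iso_annSub_quot (T : Finset I) (V : GMod.{uk, uI, uA, uV} A)
    (h : UnitSurjective T (annSub T V).quot) :
    ∃ φ : GMod.Iso (annSub T V).quot (jStar T (trunc T V)),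
      ∀ v, φ.toEquiv ((annSub T V).proj v) = (unit T V).toLin v := by
  have hker : ∀ v, (unit T V).toLin v = 0 ↔ v ∈ (annSub T V).toSubmodule := by
    intro v
    constructor
    · intro hv a
      -- The vanishing of x ↦ x v on eA is tested at x = e a.
      have hmem : A.idem T * (A.idem T * a) = A.idem T * a := by
        rw [← mul_assoc, A.idem_mul_idem]
      exact congrArg (fun f => truncIncl T V (jStarEval T (trunc T V) f ⟨_, hmem⟩)) hv
    · intro hv
      refine Subtype.ext (LinearMap.ext fun x => Subtype.ext ?_)
      change V.act (x : A) v = 0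
      rw [← show A.idem T * (x : A) = x from x.2]
      exact hv x
  let f : GMod.Hom (annSub T V).quot (jStar T (trunc T V)) :=
    { toLin := (annSub T V).toSubmodule.liftQ (unit T V).toLin fun v hv => (hker v).2 hv
      map_act := by
        intro a v
        obtain ⟨v, rfl⟩ := (annSub T V).toSubmodule.mkQ_surjective v
        exact (unit T V).map_act a v
      map_deg := by
        rintro d _ ⟨v, hv, rfl⟩
        exact (unit T V).map_deg d v hv }
  refine ⟨f.toIso ⟨?_, ?_⟩, fun v => rfl⟩
  · refine (injective_iff_map_eq_zero f.toLin).2 fun v hv => ?_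
    obtain ⟨v, rfl⟩ := (annSub T V).toSubmodule.mkQ_surjective v
    exact (Submodule.Quotient.mk_eq_zero _).2 ((hker v).1 hv)
  · rintro ⟨p, hp⟩
    refine Submodule.span_induction (p := fun p hp => ∃ v, f.toLin v = ⟨p, hp⟩) ?_ ?_ ?_ ?_ hp
    · rintro p ⟨i, d, hp⟩
      have hq : (annSub T V).proj ∘ₗ truncIncl T V ∘ₗ p ∈
          homToModule T (annSub T V).quot i d :=
        comp_mem_homToModule (annSub T V).projHom (f := truncIncl T V ∘ₗ p)
          ⟨fun b x => congrArg (truncIncl T V) (hp.1 b x),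
            fun x => congrArg (truncIncl T V) (hp.2.1 x), hp.2.2⟩
      obtain ⟨m, -, hm⟩ := h i d _ hq
      obtain ⟨v, rfl⟩ := (annSub T V).toSubmodule.mkQ_surjective m
      refine ⟨(annSub T V).proj v, Subtype.ext (LinearMap.ext fun x => Subtype.ext ?_)⟩
      change V.act (x : A) v = truncIncl T V (p x)
      -- The representing vector in V/V^Γ is lifted to v, so p(x) and x v agree only modulo V^Γ.
      -- Both are fixed by e, which annihilates V^Γ, so they are equal.
      have h1 : truncIncl T V (p x) - V.act (x : A) v ∈ (annSub T V).toSubmodule :=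
        (Submodule.Quotient.eq _).1 (hm x)
      have h2 := h1 (A.idem T)
      rw [A.idem_mul_idem, map_sub, ← V.act_mul,
        show A.idem T * (x : A) = x from x.2, sub_eq_zero] at h2
      exact h2.symm.trans (p x).2
    · exact ⟨0, map_zero _⟩
    · rintro x y hx hy ⟨v, hv⟩ ⟨w, hw⟩
      exact ⟨v + w, by rw [map_add, hv, hw]; rfl⟩
    · rintro c x hx ⟨v, hv⟩
      exact ⟨c • v, by rw [map_smul, hv]; rfl⟩

end Homs

/-! ### Induction along flags. -/

namespace TriBasis

variable {k : Type uk} [Field k] {I : Type uI} {A : GAlg.{uk, uI, uA} k I}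
  {Λ : Type uL} [PartialOrder Λ] (B : TriBasis A Λ) {Γ : Finset Λ}

theorem HasBarDeltaFlag.counitInjective {B : TriBasis A Λ} (hΓ : IsLowerSet (Γ : Set Λ))
    {V : GMod.{uk, uI, uA, uV} A} (hV : B.HasBarDeltaFlag V) :
    CounitInjective (B.indices Γ) V := by
  obtain ⟨n, F, wts, hF, h0, hn, -, hlayer⟩ := hV
  have key : ∀ r, CounitInjective (B.indices Γ) (F r).toGMod := by
    intro r
    induction r using Fin.induction with
    | zero => exact counitInjective_of_trunc_eq_zero (GSub.act_eq_zero_of_eq_bot h0 _)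
    | succ r ih =>
      obtain ⟨W, -, -, ⟨φ⟩⟩ := hlayer r
      exact GSub.counitInjective_of_subquot _ _ (hF r) φ ih
        (B.counitInjective_standardize hΓ W)
  exact counitInjective_of_surjective (F (Fin.last n)).inclHom Subtype.val_injective
    (fun v _ => ⟨⟨v, hn ▸ Submodule.mem_top⟩, rfl⟩) (key _)

theorem HasBarNablaFlag.unitSurjective {B : TriBasis A Λ} (hΓ : IsLowerSet (Γ : Set Λ))
    {V : GMod.{uk, uI, uA, uV} A} (hV : B.HasBarNablaFlag V) :
    UnitSurjective (B.indices Γ) V := by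
  obtain ⟨n, F, wts, hF, h0, hn, -, hlayer⟩ := hV
  have key : ∀ r, UnitSurjective (B.indices Γ) (F r).toGMod := by
    intro r
    -- A ∇̄-flag is indexed downwards from V to 0, so the induction starts at the last index, where
    -- the submodule is zero.
    induction r using Fin.reverseInduction with
    | last => exact unitSurjective_of_trunc_eq_zero (GSub.act_eq_zero_of_eq_bot hn _)
    | cast r ih =>
      obtain ⟨W, -, -, ⟨φ⟩⟩ := hlayer r
      exact GSub.unitSurjective_of_subquot _ _ (hF r) φ ih
        (B.unitSurjective_costandardize hΓ W)
  exact (key 0).of_bijective (F 0).inclHom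
    ⟨Subtype.val_injective, fun v => ⟨⟨v, h0 ▸ Submodule.mem_top⟩, rfl⟩⟩

end TriBasis
end GradedTriangular

open GradedTriangular in
theorem mainTheorem10 {k : Type uk} [Field k] [IsAlgClosed k] {I : Type uI}
    (A : GAlg.{uk, uI, uA} k I) (hA : A.LocFinDimBddBelow)
    {Λ : Type uL} [PartialOrder Λ] (B : TriBasis A Λ)
    (Γ : Finset Λ) (hΓ : IsLowerSet (Γ : Set Λ)) (V : GMod.{uk, uI, uA, uV} A) :
    (B.HasBarDeltaFlag (genSub (B.indices Γ) V).toGMod →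
      ∃ φ : GMod.Iso (jShriek (B.indices Γ) (trunc (B.indices Γ) V))
          (genSub (B.indices Γ) V).toGMod,
        ∀ z, (genSub (B.indices Γ) V).incl (φ.toEquiv z) = (counit (B.indices Γ) V).toLin z) ∧
    (B.HasBarNablaFlag (annSub (B.indices Γ) V).quot →
      ∃ φ : GMod.Iso (annSub (B.indices Γ) V).quot
          (jStar (B.indices Γ) (trunc (B.indices Γ) V)),
        ∀ v, φ.toEquiv ((annSub (B.indices Γ) V).proj v) = (unit (B.indices Γ) V).toLin v) := by
  exact ⟨fun h => exists_iso_genSub _ V (h.counitInjective hΓ),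
    fun h => exists_iso_annSub_quot _ V (h.unitSurjective hΓ)⟩
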